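/- Let $K$ be an algebraically closed field and let $K((t^{\mathbb Q}))$ be the field of formal series with well-ordered exponents in $\mathbb Q$ and coefficients in $K$; write $\bar\nu$ for its $t$-adic valuation. Let $A=K[x,y]_{(x,y)}$. For subsets $S,M$ of $\mathbb Q$ with $S+M\subseteq M$, where $S$ is a semigroup, say that $M$ is a finitely generated $S$-module if $M=\bigcup_{j=1}^k(S+m_j)$ for finitely many $m_1,\dots,m_k\in M$. (a) There is an embedding of $K$-algebras $K(x,y)\subset K((t^{\mathbb Q}))$ such that $\bar\nu$ restricted to $K(x,y)$ dominates $A$ and has value group $\mathbb Q$. Fix any such embedding and let $F_0=\bar\nu(A\setminus\{0\})$. (b) Put $z_0=0$. There are sequences $\lambda_i,\alpha_i,\tau_i\in\mathbb Q_{>0}$ and $f_i,g_i\in K[x,y]$, $g_i\neq0$ ($i\ge1$), such that, with $z_i=z_{i-1}+f_i/g_i$ and with $\Gamma_i$ the set of values of the nonzero elements of $A[z_i]_{(x,y,z_i)}\subset K(x,y)$, for all $i\geq 1$: $\tau_i=\max\{\bar\nu(p(x,y,z_{i-1})) : p\in K[x,y,z],\ \deg p\le i,\ p(x,y,z_{i-1})\ne0\}$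 (total degree); $\lambda_i\notin\Gamma_{i-1}$; $\lambda_i>\tau_i+\bar\nu(g_1\cdots g_{i-1})$, and $\lambda_i>\lambda_{i-1}+\bar\nu(g_1\cdots g_{i-1})$ if $i\ge2$; $\alpha_i=\lambda_i-\bar\nu(g_1\cdots g_{i-1})$ and $\bar\nu(f_i/g_i)=\alpha_i$. (c) For every such choice of sequences the limit $\underline z=\lim z_i$ exists in $K((t^{\mathbb Q}))$ and is transcendental over $K(x,y)$. For every $n\ge1$ the $F_0$-module $$T^n=\{\bar\nu(a_0+a_1\underline z+\dots+a_n\underline z^n) : a_0,\dots,a_n\in K[x,y] \text{ not all } 0\}$$ is not finitely generated. The ring $B=A[\underline z]_{(x,y,\underline z)}\subset K((t^{\mathbb Q}))$ is a three-dimensional local ring dominated by $\bar\nu$, and $T^\infty=\bar\nu(B\setminus\{0\})$ is not a finitely generated $F_0$-module. (d) For every such $\underline z$, let $R=K[x,y,u,v]_{(x,y,u,v)}$. There is a rank $2$ valuation $\nu$ of $K(x,y,u,v)$ with value group $\mathbb Z\times\mathbb Q$, ordered lexicographically, which dominates $R$ and is a composite $\nu=\nu_1\circ\bar\nu$, where $\nu_1$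 is the first component of $\nu$, with value group $\mathbb Z$, and the valuation $\bar\nu$ induced by $\nu$ on the residue field of $\nu_1$ has value group $\mathbb Q$ and is the pullback of the $t$-adic valuation under an embedding of this residue field in $K((t^{\mathbb Q}))$ which extends the given one on $K(x,y)$ and sends the class of $v/u$ to $\underline z$. If $P$ is the center of $\nu_1$ on $R$, then $R/P\cong K[x,y]_{(x,y)}$ as $K$-algebras. With $\mathcal P_\gamma=\{f\in R:\nu(f)\ge\gamma\}$ and $\mathcal P_\gamma^+=\{f\in R:\nu(f)>\gamma\}$ for $\gamma\in\mathbb Z\times\mathbb Q$, the graded module $$\mathrm{gr}_{\mathcal F(n)}\mathcal P_n/\mathcal P_n^+=\bigoplus_{\delta\in\mathbb Q}\mathcal P_{(n,\delta)}/\mathcal P_{(n,\delta)}^+$$ is, for every positive integer $n$, not finitely generated over the graded ring $\mathrm{gr}_{\bar\nu}R/P=\bigoplus_{\delta\in\mathbb Q_{\ge0}}\mathcal P_{(0,\delta)}/\mathcal P_{(0,\delta)}^+$. -/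

import Mathlib

open scoped DirectSum

noncomputable section

namespace ValSemigroup

universe u

/-! ### Local rings of affine space at the origin -/

instance isPrime_idealOfVars (σ K : Type*) [Field K] :
    (MvPolynomial.idealOfVars σ K).IsPrime := by
  have h : MvPolynomial.idealOfVars σ K
      = RingHom.ker (MvPolynomial.constantCoeff : MvPolynomial σ K →+* K) := by
    ext p
    have := MvPolynomial.mem_pow_idealOfVars_iff' (R := K) 1 p
    rw [pow_one] at this
    rw [this, RingHom.mem_ker, MvPolynomial.constantCoeff_eq]
    constructor
    · intro h
      exact h 0 (by simp)
    · intro h x hx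
      have hx0 : x = 0 := by
        rw [← Finsupp.degree_eq_zero_iff]; omega
      rw [hx0]; exact h
  rw [h]
  exact RingHom.ker_isPrime _

/-- The local ring `K[x_i : i ∈ σ]_{(x_i : i ∈ σ)}`. -/
abbrev LocRing (σ K : Type*) [Field K] : Type _ :=
  Localization.AtPrime (MvPolynomial.idealOfVars σ K)

instance isDomain_locRing (σ K : Type*) [Field K] : IsDomain (LocRing σ K) :=
  IsLocalization.isDomain_localization
    (MvPolynomial.idealOfVars σ K).primeCompl_le_nonZeroDivisors

/-- The rational function field `K(x_i : i ∈ σ)`, as the fraction field of `LocRing σ K`. -/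
def FunField (σ K : Type*) [Field K] : Type _ := FractionRing (LocRing σ K)

section FunField

variable (σ K : Type*) [Field K]

instance : Field (FunField σ K) := inferInstanceAs (Field (FractionRing (LocRing σ K)))

instance : Algebra (LocRing σ K) (FunField σ K) :=
  OreLocalization.instAlgebra (R₀ := LocRing σ K) (R := LocRing σ K)

instance : IsFractionRing (LocRing σ K) (FunField σ K) :=
  Localization.isLocalization (M := nonZeroDivisors (LocRing σ K))

instance : Algebra (MvPolynomial σ K) (FunField σ K) :=
  ((algebraMap (LocRing σ K) (FunField σ K)).comp
    (algebraMap (MvPolynomial σ K) (LocRing σ K))).toAlgebra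

instance : Algebra K (FunField σ K) :=
  ((algebraMap (LocRing σ K) (FunField σ K)).comp (algebraMap K (LocRing σ K))).toAlgebra

instance : IsScalarTower (MvPolynomial σ K) (LocRing σ K) (FunField σ K) :=
  IsScalarTower.of_algebraMap_eq fun _ => rfl

instance : IsScalarTower K (LocRing σ K) (FunField σ K) :=
  IsScalarTower.of_algebraMap_eq fun _ => rfl

instance : IsScalarTower K (MvPolynomial σ K) (FunField σ K) :=
  IsScalarTower.of_algebraMap_eq fun c =>
    congrArg (algebraMap (LocRing σ K) (FunField σ K))
      (IsScalarTower.algebraMap_apply K (MvPolynomial σ K) (LocRing σ K) c)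

end FunField

/-- A polynomial, regarded as a rational function. -/
def ratFun {σ K : Type*} [Field K] (p : MvPolynomial σ K) : FunField σ K :=
  algebraMap (MvPolynomial σ K) (FunField σ K) p

/-! ### Valuations -/

section Valuations

variable {L : Type*} [Field L] {Γ : Type*} [AddCommGroup Γ] [LinearOrder Γ] [IsOrderedAddMonoid Γ]

/-- The valuation `v` dominates the local ring `S`, included in the field `L` through `j`:
`S` is contained in the valuation ring and its maximal ideal (its set of nonunits) is the trace of
the maximal ideal of the valuation ring. -/
def Dominates {S : Type*} [CommRing S] (v : AddValuation L (WithTop Γ)) (j : S →+* L) : Prop :=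
  Function.Injective j ∧ IsLocalRing S ∧
    ∀ a : S, 0 ≤ v (j a) ∧ (a ∈ nonunits S ↔ 0 < v (j a))

/-- The value group of `v` is all of `Γ`. -/
def HasValueGroup (v : AddValuation L (WithTop Γ)) : Prop :=
  ∀ γ : Γ, ∃ f : L, v f = (γ : WithTop Γ)

/-- The valuation ring `{f | v f ≥ 0}`. -/
abbrev valRing (v : AddValuation L (WithTop Γ)) : ValuationSubring L :=
  (AddValuation.toValuation v).valuationSubring

theorem mem_valRing (v : AddValuation L (WithTop Γ)) (f : L) : f ∈ valRing v ↔ 0 ≤ v f :=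
  Iff.rfl

/-- The rank of a valuation: the Krull dimension of its valuation ring. -/
def valRank (v : AddValuation L (WithTop Γ)) : WithBot ℕ∞ := ringKrullDim (valRing v)

/-- `ν`, with values in `ℤ × ℚ` ordered lexicographically, is the composite `ν₁ ∘ νb` of the
valuation `ν₁` of `L` (values in the quotient of `ℤ × ℚ` by the convex subgroup `0 × ℚ`) and of the
valuation `νb` of the residue field of `ν₁` (values in `0 × ℚ`). -/
def IsComposite (ν : AddValuation L (WithTop (ℤ ×ₗ ℚ))) (ν₁ : AddValuation L (WithTop ℤ))
    (νb : AddValuation (IsLocalRing.ResidueField (valRing ν₁)) (WithTop ℚ)) : Prop :=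
  (∀ f : L, ν₁ f = (ν f).map (fun γ => (ofLex γ).1)) ∧
  ∀ f : valRing ν₁, ν₁ (f : L) = 0 →
    νb (IsLocalRing.residue (valRing ν₁) f) = (ν (f : L)).map (fun γ => (ofLex γ).2)

end Valuations

/-! ### Associated graded rings and modules -/

section Graded

variable {R : Type*} [CommRing R] {Γ : Type*} [AddCommGroup Γ] [LinearOrder Γ]
  [IsOrderedAddMonoid Γ]

/-- `𝒫_γ = {f ∈ R | v f ≥ γ}`. -/
def valIdeal (v : AddValuation R (WithTop Γ)) (γ : Γ) : AddSubgroup R where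
  carrier := {f | (γ : WithTop Γ) ≤ v f}
  zero_mem' := by simp
  add_mem' := fun ha hb => v.map_le_add ha hb
  neg_mem' := fun ha => by simpa using ha

/-- `𝒫⁺_γ = {f ∈ R | v f > γ}`. -/
def valIdealPlus (v : AddValuation R (WithTop Γ)) (γ : Γ) : AddSubgroup R where
  carrier := {f | (γ : WithTop Γ) < v f}
  zero_mem' := by simp
  add_mem' := fun ha hb => v.map_lt_add ha hb
  neg_mem' := fun ha => by simpa using ha

/-- The quotient `𝒫_γ / 𝒫⁺_γ`. -/
def GrComp (v : AddValuation R (WithTop Γ)) (γ : Γ) : Type _ :=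
  valIdeal v γ ⧸ (valIdealPlus v γ).addSubgroupOf (valIdeal v γ)

instance (v : AddValuation R (WithTop Γ)) (γ : Γ) : AddCommGroup (GrComp v γ) :=
  inferInstanceAs (AddCommGroup (valIdeal v γ ⧸ (valIdealPlus v γ).addSubgroupOf (valIdeal v γ)))

/-- The class in `𝒫_γ / 𝒫⁺_γ` of an element of `𝒫_γ`. -/
def GrComp.mk (v : AddValuation R (WithTop Γ)) (γ : Γ) : valIdeal v γ →+ GrComp v γ :=
  QuotientAddGroup.mk' _

theorem GrComp.mk_surjective (v : AddValuation R (WithTop Γ)) (γ : Γ) :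
    Function.Surjective (GrComp.mk v γ) := QuotientAddGroup.mk'_surjective _

theorem GrComp.mk_eq_zero (v : AddValuation R (WithTop Γ)) (γ : Γ) (a : valIdeal v γ) :
    GrComp.mk v γ a = 0 ↔ (γ : WithTop Γ) < v (a : R) :=
  (QuotientAddGroup.eq_zero_iff a).trans AddSubgroup.mem_addSubgroupOf

/-- The product of an element of `𝒫_a` and an element of `𝒫_b` lies in `𝒫_{a + b}`. -/
def preMul (v : AddValuation R (WithTop Γ)) {a b c : Γ} (h : a + b = c) :
    valIdeal v a →+ valIdeal v b →+ valIdeal v c :=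
  AddMonoidHom.mk' (fun f => AddMonoidHom.mk' (fun g => ⟨(f : R) * (g : R), by
      change (c : WithTop Γ) ≤ v ((f : R) * g)
      rw [v.map_mul, ← h, WithTop.coe_add]
      exact add_le_add f.2 g.2⟩)
    (fun g g' => Subtype.ext (mul_add _ _ _)))
    (fun f f' => AddMonoidHom.ext fun g => Subtype.ext (add_mul (f : R) f' g))

/-- Multiplication `𝒫_a / 𝒫⁺_a × 𝒫_b / 𝒫⁺_b → 𝒫_{a + b} / 𝒫⁺_{a + b}`, induced by that of `R`. -/
def GrComp.mul (v : AddValuation R (WithTop Γ)) {a b c : Γ} (h : a + b = c) :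
    GrComp v a →+ GrComp v b →+ GrComp v c :=
  QuotientAddGroup.lift _
    (AddMonoidHom.mk' (fun f => QuotientAddGroup.lift _
        ((GrComp.mk v c).comp (preMul v h f)) (by
          intro g hg
          refine (GrComp.mk_eq_zero v c _).2 ?_
          change (c : WithTop Γ) < v ((f : R) * g)
          rw [v.map_mul, ← h, WithTop.coe_add]
          exact WithTop.add_lt_add_of_le_of_lt WithTop.coe_ne_top f.2
            (AddSubgroup.mem_addSubgroupOf.1 hg)))
      (fun f f' => by
        refine AddMonoidHom.ext fun g' => ?_
        obtain ⟨g, rfl⟩ := GrComp.mk_surjective v b g'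
        exact congrArg (GrComp.mk v c) (Subtype.ext (add_mul (f : R) f' g))))
    (by
      intro f hf
      refine AddMonoidHom.ext fun g' => ?_
      obtain ⟨g, rfl⟩ := GrComp.mk_surjective v b g'
      refine (GrComp.mk_eq_zero v c _).2 ?_
      change (c : WithTop Γ) < v ((f : R) * g)
      rw [v.map_mul, ← h, WithTop.coe_add]
      exact WithTop.add_lt_add_of_lt_of_le WithTop.coe_ne_top
        (AddSubgroup.mem_addSubgroupOf.1 hf) g.2)

theorem GrComp.mul_mk (v : AddValuation R (WithTop Γ)) {a b c : Γ} (h : a + b = c)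
    (f : valIdeal v a) (g : valIdeal v b) :
    GrComp.mul v h (GrComp.mk v a f) (GrComp.mk v b g) = GrComp.mk v c (preMul v h f g) := rfl

end Graded

section GradedLex

variable {R : Type*} [CommRing R] (v : AddValuation R (WithTop (ℤ ×ₗ ℚ)))

/-- The component of degree `(n, δ)` of the graded ring of `v`. -/
def GrPart (n : ℤ) (δ : ℚ) : Type _ := GrComp v (toLex (n, δ))

instance (n : ℤ) (δ : ℚ) : AddCommGroup (GrPart v n δ) :=
  inferInstanceAs (AddCommGroup (GrComp v (toLex (n, δ))))

/-- The class of an element of `𝒫_{(n, δ)}`. -/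
def GrPart.mk (n : ℤ) (δ : ℚ) : valIdeal v (toLex (n, δ)) →+ GrPart v n δ := GrComp.mk v _

theorem GrPart.ind {n : ℤ} {δ : ℚ} {p : GrPart v n δ → Prop}
    (h : ∀ f, p (GrPart.mk v n δ f)) (a : GrPart v n δ) : p a := by
  obtain ⟨f, rfl⟩ := GrComp.mk_surjective v _ a
  exact h f

theorem toLex_zero_add (n : ℤ) (δ ε : ℚ) :
    (toLex ((0 : ℤ), δ) : ℤ ×ₗ ℚ) + toLex (n, ε) = toLex (n, δ + ε) :=
  congrArg toLex (Prod.ext (zero_add n) rfl)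

/-- Multiplication of components of degrees `(0, δ)` and `(n, ε)`. -/
def GrPart.mul {n : ℤ} {δ ε : ℚ} : GrPart v 0 δ →+ GrPart v n ε →+ GrPart v n (δ + ε) :=
  GrComp.mul v (toLex_zero_add n δ ε)

theorem GrPart.sigma_mk_eq {n : ℤ} {δ ε : ℚ} (h : δ = ε) (f : valIdeal v (toLex (n, δ)))
    (g : valIdeal v (toLex (n, ε))) (hfg : (f : R) = g) :
    (⟨δ, GrPart.mk v n δ f⟩ : Σ i, GrPart v n i) = ⟨ε, GrPart.mk v n ε g⟩ := by
  subst h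
  rw [Subtype.ext hfg]

/-- The class of `1` in degree `(0, 0)`. -/
def GrPart.one : GrPart v 0 0 := GrPart.mk v 0 0 ⟨1, by
  change ((toLex ((0 : ℤ), (0 : ℚ)) : ℤ ×ₗ ℚ) : WithTop (ℤ ×ₗ ℚ)) ≤ v 1
  rw [v.map_one]; exact le_refl _⟩

instance : GradedMonoid.GMul (GrPart v 0) := ⟨fun a b => GrPart.mul v a b⟩

instance : GradedMonoid.GOne (GrPart v 0) := ⟨GrPart.one v⟩

instance : DirectSum.GCommRing (GrPart v 0) where
  mul a b := GrPart.mul v a b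
  mul_zero a := map_zero _
  zero_mul b := by rw [map_zero]; rfl
  mul_add a b c := map_add _ _ _
  add_mul a b c := by rw [map_add]; rfl
  one := GrPart.one v
  one_mul := by
    rintro ⟨i, a⟩
    induction a using GrPart.ind with
    | h f => exact GrPart.sigma_mk_eq v (zero_add i) _ _ (one_mul _)
  mul_one := by
    rintro ⟨i, a⟩
    induction a using GrPart.ind with
    | h f => exact GrPart.sigma_mk_eq v (add_zero i) _ _ (mul_one _)
  mul_assoc := by
    rintro ⟨i, a⟩ ⟨j, b⟩ ⟨k, c⟩
    induction a using GrPart.ind with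
    | h f =>
      induction b using GrPart.ind with
      | h g =>
        induction c using GrPart.ind with
        | h l => exact GrPart.sigma_mk_eq v (add_assoc i j k) _ _ (mul_assoc _ _ _)
  mul_comm := by
    rintro ⟨i, a⟩ ⟨j, b⟩
    induction a using GrPart.ind with
    | h f =>
      induction b using GrPart.ind with
      | h g => exact GrPart.sigma_mk_eq v (add_comm i j) _ _ (mul_comm _ _)
  natCast m := m • GrPart.one v
  natCast_zero := zero_smul _ _
  natCast_succ m := succ_nsmul _ _
  intCast m := m • GrPart.one v
  intCast_ofNat m := natCast_zsmul _ _
  intCast_negSucc_ofNat m := negSucc_zsmul _ _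

instance (n : ℤ) : DirectSum.Gmodule (GrPart v 0) (GrPart v n) where
  smul a b := GrPart.mul v a b
  smul_zero a := map_zero _
  zero_smul b := by
    change GrPart.mul v 0 b = 0
    rw [map_zero]; rfl
  smul_add a b c := map_add _ _ _
  add_smul a b c := by
    change GrPart.mul v (a + b) c = GrPart.mul v a c + GrPart.mul v b c
    rw [map_add]; rfl
  one_smul := by
    rintro ⟨i, a⟩
    induction a using GrPart.ind with
    | h f => exact GrPart.sigma_mk_eq v (zero_add i) _ _ (one_mul _)
  mul_smul := by
    rintro ⟨i, a⟩ ⟨j, b⟩ ⟨k, c⟩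
    induction a using GrPart.ind with
    | h f =>
      induction b using GrPart.ind with
      | h g =>
        induction c using GrPart.ind with
        | h l => exact GrPart.sigma_mk_eq v (add_assoc i j k) _ _ (mul_assoc _ _ _)

/-- The graded ring `gr_{νb} R/P = ⨁_δ 𝒫_{(0, δ)} / 𝒫⁺_{(0, δ)}`, where `P = {f | v f > 0 × ℚ}`
and `νb` is the valuation of `R/P` induced by `v`. (All the `𝒫_{(0, δ)}` and `𝒫⁺_{(0, δ)}` contain
`P`; the components with `δ < 0` vanish as soon as `v` is nonnegative on `R`.) -/
abbrev GrResidual : Type _ := ⨁ δ : ℚ, GrPart v 0 δ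

/-- The graded module `gr_{ℱ(n)} 𝒫_n / 𝒫_n⁺ = ⨁_δ 𝒫_{(n, δ)} / 𝒫⁺_{(n, δ)}` over `gr_{νb} R/P`:
the sum of the components of the graded ring of `v` whose degree has first coordinate `n`. -/
abbrev GrSlice (n : ℤ) : Type _ := ⨁ δ : ℚ, GrPart v n δ

end GradedLex

/-! ### Semigroups of values in `K((t^ℚ))` -/

/-- `M = ⋃_j (S + m_j)` for finitely many `m_j ∈ M`: the set `M` is a finitely generated module
over the semigroup `S`. -/
def IsFGOver (S M : Set ℚ) : Prop :=
  ∃ m : Finset ℚ, (m : Set ℚ) ⊆ M ∧ M = {q | ∃ s ∈ S, ∃ a ∈ m, q = s + a}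

section Series

variable {K : Type u} [Field K]

/-- The `t`-adic valuation of the field `K((t^ℚ))` of series with well-ordered exponents. -/
abbrev tVal (K : Type u) [Field K] : AddValuation (HahnSeries ℚ K) (WithTop ℚ) :=
  HahnSeries.addVal ℚ K

/-- An embedding of `K(x, y)` in `K((t^ℚ))` such that the restriction of the `t`-adic valuation
dominates `K[x, y]_{(x, y)}` and has value group `ℚ`. -/
def IsAdmissible (ι : FunField (Fin 2) K →ₐ[K] HahnSeries ℚ K) : Prop :=
  Dominates (tVal K) ((ι : FunField (Fin 2) K →+* HahnSeries ℚ K).comp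
      (algebraMap (LocRing (Fin 2) K) (FunField (Fin 2) K))) ∧
    HasValueGroup ((tVal K).comap (ι : FunField (Fin 2) K →+* HahnSeries ℚ K))

variable (ι : FunField (Fin 2) K →ₐ[K] HahnSeries ℚ K)

/-- The valuation of `K(x, y)` induced by the `t`-adic one. -/
abbrev val2 : AddValuation (FunField (Fin 2) K) (WithTop ℚ) :=
  (tVal K).comap (ι : FunField (Fin 2) K →+* HahnSeries ℚ K)

/-- Evaluation `K[x, y, z] → K((t^ℚ))`, `z ↦ w`. -/
def evalZ (w : HahnSeries ℚ K) : MvPolynomial (Fin 3) K →ₐ[K] HahnSeries ℚ K :=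
  MvPolynomial.aeval
    ![ι (ratFun (MvPolynomial.X 0)), ι (ratFun (MvPolynomial.X 1)), w]

/-- `F₀`: the semigroup of values on `A = K[x, y]_{(x, y)}`. -/
def F0 : Set ℚ :=
  {q | ∃ a : LocRing (Fin 2) K, val2 ι (algebraMap _ (FunField (Fin 2) K) a) = (q : WithTop ℚ)}

/-- The subring `K[x, y, w]_{(x, y, w)} = A[w]_{(x, y, w)}` of `K((t^ℚ))`, for `w` of positive
value: the fractions `a(w) / s(w)` with `s ∉ (x, y, z)`. -/
def locAt (w : HahnSeries ℚ K) : Subring (HahnSeries ℚ K) where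
  carrier := {b | ∃ a s : MvPolynomial (Fin 3) K,
    MvPolynomial.constantCoeff s ≠ 0 ∧ b = evalZ ι w a / evalZ ι w s}
  zero_mem' := ⟨0, 1, by simp, by simp⟩
  one_mem' := ⟨1, 1, by simp, by simp⟩
  mul_mem' := by
    rintro _ _ ⟨a, s, hs, rfl⟩ ⟨b, t, ht, rfl⟩
    exact ⟨a * b, s * t, by simp [hs, ht], by rw [map_mul, map_mul, div_mul_div_comm]⟩
  neg_mem' := by
    rintro _ ⟨a, s, hs, rfl⟩
    exact ⟨-a, s, hs, by rw [map_neg, neg_div]⟩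
  add_mem' := by
    rintro _ _ ⟨a, s, hs, rfl⟩ ⟨b, t, ht, rfl⟩
    by_cases h1 : evalZ ι w s = 0
    · exact ⟨b, t, ht, by simp [h1]⟩
    by_cases h2 : evalZ ι w t = 0
    · exact ⟨a, s, hs, by simp [h2]⟩
    exact ⟨a * t + s * b, s * t, by simp [hs, ht], by
      rw [map_add, map_mul, map_mul, map_mul, div_add_div _ _ h1 h2]⟩

/-- The set of values of the nonzero elements of `A[w]_{(x, y, w)}`. -/
def locValues (w : HahnSeries ℚ K) : Set ℚ :=
  {q | ∃ b ∈ locAt ι w, tVal K b = (q : WithTop ℚ)}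

/-- The set of values of the nonzero `a₀ + a₁ w + ⋯ + aₙ wⁿ` with `aᵢ ∈ K[x, y]`. -/
def polyValues (w : HahnSeries ℚ K) (n : ℕ) : Set ℚ :=
  {q | ∃ p : MvPolynomial (Fin 3) K, p.degreeOf 2 ≤ n ∧ tVal K (evalZ ι w p) = (q : WithTop ℚ)}

/-- The value of `g₀ ⋯ g_{i-1}`. -/
def prodVal (g : ℕ → MvPolynomial (Fin 2) K) (i : ℕ) : WithTop ℚ :=
  val2 ι (ratFun (∏ j ∈ Finset.range i, g j))

/-- The partial sum `z_i = f₀ / g₀ + ⋯ + f_{i-1} / g_{i-1}`, in `K((t^ℚ))`. -/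
def partialZ (f g : ℕ → MvPolynomial (Fin 2) K) (i : ℕ) : HahnSeries ℚ K :=
  ι (∑ j ∈ Finset.range i, ratFun (f j) / ratFun (g j))

/-- Choices `λ, α, τ, f, g` in the inductive construction of the series; the index `i` here is
`i + 1` in the usual numbering from `1`, except that `partialZ ι f g i` is the sum of the first `i`
terms, so that `z₀ = 0`. -/
structure IsConstruction (lam alpha tau : ℕ → ℚ) (f g : ℕ → MvPolynomial (Fin 2) K) : Prop where
  pos : ∀ i, 0 < lam i ∧ 0 < alpha i ∧ 0 < tau i
  g_ne_zero : ∀ i, g i ≠ 0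
  /-- `tau i` is the largest value at `z_i` of a polynomial of total degree at most `i + 1` which
  does not vanish at `z_i`. -/
  tau_max : ∀ i, IsGreatest {q : ℚ | ∃ p : MvPolynomial (Fin 3) K, p.totalDegree ≤ i + 1 ∧
    tVal K (evalZ ι (partialZ ι f g i) p) = (q : WithTop ℚ)} (tau i)
  lam_notMem : ∀ i, lam i ∉ locValues ι (partialZ ι f g i)
  lam_gt_tau : ∀ i, (tau i : WithTop ℚ) + prodVal ι g i < (lam i : WithTop ℚ)
  lam_gt_lam : ∀ i, (lam i : WithTop ℚ) + prodVal ι g (i + 1) < (lam (i + 1) : WithTop ℚ)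
  alpha_eq : ∀ i, (alpha i : WithTop ℚ) + prodVal ι g i = (lam i : WithTop ℚ)
  val_eq : ∀ i, val2 ι (ratFun (f i) / ratFun (g i)) = (alpha i : WithTop ℚ)

/-- `z` is the limit of the sequence `w` for the `t`-adic valuation. -/
def IsLimit (w : ℕ → HahnSeries ℚ K) (z : HahnSeries ℚ K) : Prop :=
  ∀ M : ℚ, ∃ N : ℕ, ∀ i ≥ N, (M : WithTop ℚ) < tVal K (z - w i)

end Series

end ValSemigroup

end

open ValSemigroup

/-!
Write `H = K((t^ℚ))`. Everything rests on one approximation principle: a polynomial with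
coefficients in `K` is Lipschitz for the valuation (`le_val_aeval_sub`), so if a series `z` is
closer to `w i` than the values at `w i` of the polynomials of degree at most `i + 1`, then each
nonzero polynomial takes at `z` the same finite value as at `w i` for `i` large
(`eventually_val_aeval_eq`). Such bounds exist because the values on a finite-dimensional space of
polynomials have a maximum (`exists_isGreatest_val`).

*Embedding.* Take `x = t` and `y = ∑ t ^ e n`. A partial sum `w` is algebraic over `K(t)`, hence
killed by a nonzero polynomial `P` over `K(t)`, and Taylor expansion at `w` shows that the value of
`P(y)` is `k e + c` with `k > 0` and `c` depending on `w` only, where `e` is the next exponent. So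
`e` can be chosen with `P(y) / t ^ N` of any prescribed value (`exists_exponent`), and large enough
for the approximation principle to make `y` transcendental over `K(t)`.

*The series `z`.* The values of the Noetherian ring `K[x, y, z_i]` satisfy the descending chain
condition, hence miss arbitrarily large rational numbers (`exists_gt_forall_val_ne`), which allows
the choice of `lam i`. By the approximation principle the limit `z` is transcendental. The number
`lam i` is the value of `g₀ ⋯ g_{i-1} (z - z_i)`, while finitely many values of polynomials at `z`
are values at `z_i` for `i` large. So finitely many generators would produce values at `z_i` only,
among which `lam i` is not (`IsConstruction.not_isFGOver`).

*The rank two valuation.* Embed `K(x, y, u, v)` in `H((u))` by `v ↦ z u`, and let `ν` be the order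
in `u` together with the order in `t` of the leading coefficient. The coefficient of `u ^ n` of a
polynomial is a polynomial of degree at most `n` in `z`, and all of these occur. Hence the degrees
`δ` with `𝒫_{(n, δ)} ≠ 𝒫⁺_{(n, δ)}` form the module `Tⁿ` (`IsAdmissible.sliceValues_eq`), and finite
generation of the graded module would imply that of `Tⁿ` (`isFGOver_of_finite`).
-/

open scoped DirectSum

noncomputable section

namespace ValSemigroup

/-! ### Valuations trivial on the constants -/

section TrivialOn

variable {K L : Type*} [Field K] [Field L] [Algebra K L]
variable {Γ : Type*} [AddCommGroup Γ] [LinearOrder Γ] [IsOrderedAddMonoid Γ]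
variable {v : AddValuation L (WithTop Γ)}

variable (K) in
/-- The valuation `v` is trivial on the field of constants `K`. It suffices to require that
constants have nonnegative value, since their inverses are constants too. -/
def TrivialOn (v : AddValuation L (WithTop Γ)) : Prop :=
  ∀ c : K, 0 ≤ v (algebraMap K L c)

theorem TrivialOn.eq_zero (h : TrivialOn K v) {c : K} (hc : c ≠ 0) :
    v (algebraMap K L c) = 0 := by
  refine le_antisymm ?_ (h c)
  have h1 : v (algebraMap K L c) + v (algebraMap K L c⁻¹) = 0 := by
    rw [← v.map_mul, ← map_mul, mul_inv_cancel₀ hc, map_one, v.map_one]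
  calc v (algebraMap K L c) ≤ v (algebraMap K L c) + v (algebraMap K L c⁻¹) :=
        le_add_of_nonneg_right (h _)
    _ = 0 := h1

variable {σ : Type*}

theorem val_sub_constantCoeff_pos (hK : TrivialOn K v) (e : MvPolynomial σ K →ₐ[K] L)
    (he : ∀ i, 0 < v (e (MvPolynomial.X i))) (p : MvPolynomial σ K) :
    0 < v (e p - algebraMap K L (MvPolynomial.constantCoeff p)) := by
  induction p using MvPolynomial.induction_on with
  | C c =>
    rw [MvPolynomial.constantCoeff_C, ← MvPolynomial.algebraMap_eq, e.commutes, sub_self,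
      v.map_zero]
    exact WithTop.coe_lt_top 0
  | add p q hp hq =>
    rw [map_add, map_add, map_add, add_sub_add_comm]
    exact v.map_lt_add hp hq
  | mul_X p i hp =>
    have h0 : 0 ≤ v (e p) := by
      have := v.map_le_add hp.le (hK (MvPolynomial.constantCoeff p))
      rwa [sub_add_cancel] at this
    rw [map_mul, map_mul, MvPolynomial.constantCoeff_X, mul_zero, map_zero, sub_zero, v.map_mul]
    exact (he i).trans_le (le_add_of_nonneg_left h0)

theorem val_nonneg (hK : TrivialOn K v) (e : MvPolynomial σ K →ₐ[K] L)
    (he : ∀ i, 0 < v (e (MvPolynomial.X i))) (p : MvPolynomial σ K) : 0 ≤ v (e p) := by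
  have := v.map_le_add (val_sub_constantCoeff_pos hK e he p).le (hK (MvPolynomial.constantCoeff p))
  rwa [sub_add_cancel] at this

theorem val_pos_iff (hK : TrivialOn K v) (e : MvPolynomial σ K →ₐ[K] L)
    (he : ∀ i, 0 < v (e (MvPolynomial.X i))) (p : MvPolynomial σ K) :
    0 < v (e p) ↔ MvPolynomial.constantCoeff p = 0 := by
  have h := val_sub_constantCoeff_pos hK e he p
  constructor
  · intro hp
    by_contra hc
    rw [← v.map_neg, neg_sub] at h
    have h2 := v.map_lt_add h hp
    rw [sub_add_cancel, hK.eq_zero hc] at h2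
    exact lt_irrefl _ h2
  · intro hc
    rwa [hc, map_zero, sub_zero] at h

theorem val_eq_zero (hK : TrivialOn K v) (e : MvPolynomial σ K →ₐ[K] L)
    (he : ∀ i, 0 < v (e (MvPolynomial.X i))) {p : MvPolynomial σ K}
    (hp : MvPolynomial.constantCoeff p ≠ 0) : v (e p) = 0 :=
  le_antisymm (not_lt.1 fun h => hp ((val_pos_iff hK e he p).1 h)) (val_nonneg hK e he p)

/-- Polynomials are Lipschitz for a valuation, on points of the valuation ring. -/
theorem le_val_aeval_sub (hK : TrivialOn K v) {a b : σ → L} (ha : ∀ i, 0 ≤ v (a i))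
    (hb : ∀ i, 0 ≤ v (b i)) {γ : WithTop Γ} (h : ∀ i, γ ≤ v (a i - b i)) (p : MvPolynomial σ K) :
    γ ≤ v (MvPolynomial.aeval a p - MvPolynomial.aeval b p) := by
  have hnn : 0 ≤ v (MvPolynomial.aeval b p) ∧
      γ ≤ v (MvPolynomial.aeval a p - MvPolynomial.aeval b p) := by
    induction p using MvPolynomial.induction_on with
    | C c =>
      rw [← MvPolynomial.algebraMap_eq, AlgHom.commutes, AlgHom.commutes, sub_self, v.map_zero]
      exact ⟨hK c, le_top⟩
    | add p q hp hq =>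
      rw [map_add (MvPolynomial.aeval a), map_add (MvPolynomial.aeval b), add_sub_add_comm]
      exact ⟨v.map_le_add hp.1 hq.1, v.map_le_add hp.2 hq.2⟩
    | mul_X p i hp =>
      rw [map_mul (MvPolynomial.aeval a), map_mul (MvPolynomial.aeval b), MvPolynomial.aeval_X,
        MvPolynomial.aeval_X]
      refine ⟨by rw [v.map_mul]; exact add_nonneg hp.1 (hb i), ?_⟩
      have : MvPolynomial.aeval a p * a i - MvPolynomial.aeval b p * b i =
        (MvPolynomial.aeval a p - MvPolynomial.aeval b p) * a i +
          MvPolynomial.aeval b p * (a i - b i) := by ring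
      rw [this]
      refine v.map_le_add ?_ ?_
      · rw [v.map_mul]
        exact hp.2.trans (le_add_of_nonneg_right (ha i))
      · rw [v.map_mul]
        exact (h i).trans (le_add_of_nonneg_left hp.1)
  exact hnn.2

theorem val_eq_of_lt_val_sub {a b : L} (h : v b < v (a - b)) : v a = v b := by
  have := v.map_add_eq_of_lt_right (x := a - b) (y := b) h
  rwa [sub_add_cancel] at this

end TrivialOn

/-! ### Domination of the local ring at the origin -/

section LocRing

variable {σ K : Type*} [Field K]

theorem mem_idealOfVars_iff (p : MvPolynomial σ K) :
    p ∈ MvPolynomial.idealOfVars σ K ↔ MvPolynomial.constantCoeff p = 0 := by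
  have := MvPolynomial.mem_pow_idealOfVars_iff' (R := K) 1 p
  rw [pow_one] at this
  rw [this, MvPolynomial.constantCoeff_eq]
  refine ⟨fun h => h 0 (by simp), fun h x hx => ?_⟩
  have hx0 : x = 0 := by
    rw [← Finsupp.degree_eq_zero_iff]; omega
  rw [hx0]; exact h

theorem isUnit_algebraMap_locRing {p : MvPolynomial σ K} :
    IsUnit (algebraMap (MvPolynomial σ K) (LocRing σ K) p) ↔
      MvPolynomial.constantCoeff p ≠ 0 := by
  rw [IsLocalization.AtPrime.isUnit_to_map_iff (LocRing σ K) (MvPolynomial.idealOfVars σ K) p]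
  exact (mem_idealOfVars_iff p).not

theorem exists_mul_eq_algebraMap (a : LocRing σ K) : ∃ p s : MvPolynomial σ K,
    MvPolynomial.constantCoeff s ≠ 0 ∧
      a * algebraMap _ (LocRing σ K) s = algebraMap _ (LocRing σ K) p := by
  obtain ⟨⟨p, s⟩, h⟩ := IsLocalization.surj (MvPolynomial.idealOfVars σ K).primeCompl a
  exact ⟨p, s, fun h0 => s.2 ((mem_idealOfVars_iff _).2 h0), h⟩

theorem algebraMap_locRing_injective :
    Function.Injective (algebraMap (MvPolynomial σ K) (LocRing σ K)) :=
  IsLocalization.injective _ (MvPolynomial.idealOfVars σ K).primeCompl_le_nonZeroDivisors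

instance isFractionRing_mvPolynomial : IsFractionRing (MvPolynomial σ K) (FunField σ K) := by
  have : FaithfulSMul (MvPolynomial σ K) (FunField σ K) :=
    (faithfulSMul_iff_algebraMap_injective _ _).2
      ((IsFractionRing.injective (LocRing σ K) (FunField σ K)).comp algebraMap_locRing_injective)
  refine IsFractionRing.of_field _ _ fun z => ?_
  obtain ⟨a, b, hb, rfl⟩ := IsFractionRing.div_surjective (A := LocRing σ K) z
  obtain ⟨p, s, hs, h1⟩ := exists_mul_eq_algebraMap a
  obtain ⟨q, t, ht, h2⟩ := exists_mul_eq_algebraMap b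
  refine ⟨p * t, q * s, ?_⟩
  have hb0 : algebraMap (LocRing σ K) (FunField σ K) b ≠ 0 :=
    IsFractionRing.to_map_ne_zero_of_mem_nonZeroDivisors hb
  have inj := (IsFractionRing.injective (LocRing σ K) (FunField σ K))
  have hs0 : algebraMap (LocRing σ K) (FunField σ K) (algebraMap _ _ s) ≠ 0 :=
    ((isUnit_algebraMap_locRing.2 hs).map _).ne_zero
  have ht0 : algebraMap (LocRing σ K) (FunField σ K) (algebraMap _ _ t) ≠ 0 :=
    ((isUnit_algebraMap_locRing.2 ht).map _).ne_zero
  rw [IsScalarTower.algebraMap_apply (MvPolynomial σ K) (LocRing σ K) (FunField σ K),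
    IsScalarTower.algebraMap_apply (MvPolynomial σ K) (LocRing σ K) (FunField σ K),
    map_mul (algebraMap (MvPolynomial σ K) (LocRing σ K)) p,
    map_mul (algebraMap (MvPolynomial σ K) (LocRing σ K)) q, ← h1, ← h2]
  simp only [map_mul]
  field_simp

theorem ratFun_injective : Function.Injective (ratFun : MvPolynomial σ K → FunField σ K) :=
  IsFractionRing.injective _ _

theorem ratFun_ne_zero {p : MvPolynomial σ K} : ratFun p ≠ 0 ↔ p ≠ 0 :=
  map_ne_zero_iff (algebraMap (MvPolynomial σ K) (FunField σ K)) ratFun_injective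

theorem exists_ratFun_div (r : FunField σ K) :
    ∃ f g : MvPolynomial σ K, g ≠ 0 ∧ ratFun f / ratFun g = r := by
  obtain ⟨f, g, hg, rfl⟩ := IsFractionRing.div_surjective (A := MvPolynomial σ K) r
  exact ⟨f, g, nonZeroDivisors.ne_zero hg, rfl⟩

variable {L : Type*} [Field L] [Algebra K L]

/-- The extension to `K(x_i : i ∈ σ)` of an injective homomorphism of `K[x_i : i ∈ σ]` in a
field. -/
def liftFun (e : MvPolynomial σ K →ₐ[K] L) (he : Function.Injective e) : FunField σ K →ₐ[K] L :=
  IsFractionRing.liftAlgHom (g := e) he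

theorem liftFun_ratFun (e : MvPolynomial σ K →ₐ[K] L) (he : Function.Injective e)
    (p : MvPolynomial σ K) : liftFun e he (ratFun p) = e p :=
  IsFractionRing.lift_algebraMap (g := (e : MvPolynomial σ K →+* L)) he p

variable {Γ : Type*} [AddCommGroup Γ] [LinearOrder Γ] [IsOrderedAddMonoid Γ]
variable {v : AddValuation L (WithTop Γ)}

/-- The restriction of a homomorphism of `LocRing σ K` to polynomials. -/
abbrev onPoly (j : LocRing σ K →ₐ[K] L) : MvPolynomial σ K →ₐ[K] L :=
  j.comp (IsScalarTower.toAlgHom K (MvPolynomial σ K) (LocRing σ K))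

/-- Elements of `LocRing σ K` have the same values as polynomials, because the denominators are
units of value `0`. -/
theorem exists_val_locRing_eq (hK : TrivialOn K v) (j : LocRing σ K →ₐ[K] L)
    (hj : ∀ i, 0 < v (j (algebraMap (MvPolynomial σ K) _ (MvPolynomial.X i)))) (a : LocRing σ K) :
    ∃ p : MvPolynomial σ K, Associated a (algebraMap _ _ p) ∧
      v (j a) = v (j (algebraMap _ _ p)) := by
  obtain ⟨p, s, hs, h⟩ := exists_mul_eq_algebraMap a
  refine ⟨p, ⟨(isUnit_algebraMap_locRing.2 hs).unit, h⟩, ?_⟩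
  rw [← h, map_mul, v.map_mul]
  have : v (j (algebraMap _ _ s)) = 0 := val_eq_zero hK (onPoly j) hj hs
  rw [this, add_zero]

/-- A valuation which is trivial on `K` and positive on the variables dominates the local ring at
the origin. -/
theorem dominates_locRing (hK : TrivialOn K v) (j : LocRing σ K →ₐ[K] L)
    (hinj : Function.Injective j)
    (hj : ∀ i, 0 < v (j (algebraMap (MvPolynomial σ K) _ (MvPolynomial.X i)))) :
    Dominates v (j : LocRing σ K →+* L) := by
  refine ⟨hinj, inferInstance, fun a => ?_⟩
  obtain ⟨p, hp, h⟩ := exists_val_locRing_eq hK j hj a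
  change 0 ≤ v (j a) ∧ (a ∈ nonunits _ ↔ 0 < v (j a))
  rw [h]
  refine ⟨val_nonneg hK (onPoly j) hj p, ?_⟩
  rw [mem_nonunits_iff, hp.isUnit_iff, isUnit_algebraMap_locRing, not_not]
  exact (val_pos_iff hK (onPoly j) hj p).symm

end LocRing

/-! ### Sets of values, generic points and limits -/

section ValueSets

variable {K L : Type*} [Field K] [Field L] [Algebra K L]
variable {Γ : Type*} [AddCommGroup Γ] [LinearOrder Γ] [IsOrderedAddMonoid Γ]
variable {v : AddValuation L (WithTop Γ)}

/-- The values of polynomials of bounded degree have a maximum: the subspaces `{v ≥ q}` of a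
finite-dimensional space satisfy the descending chain condition. -/
theorem exists_isGreatest_val {σ : Type*} [Finite σ] (hK : TrivialOn K v)
    (e : MvPolynomial σ K →ₐ[K] L) (d : ℕ) :
    ∃ m : Γ, IsGreatest {q : Γ | ∃ p : MvPolynomial σ K, p.totalDegree ≤ d ∧
      v (e p) = (q : WithTop Γ)} m := by
  let W := MvPolynomial.restrictTotalDegree σ K d
  let U : Γ → Submodule K W := fun q =>
    { carrier := {w | (q : WithTop Γ) ≤ v (e w)}
      zero_mem' := by simp
      add_mem' := fun {a b} ha hb => by
        change (q : WithTop Γ) ≤ v (e ((a : MvPolynomial σ K) + b))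
        rw [map_add]
        exact v.map_le_add ha hb
      smul_mem' := fun c w hw => by
        change (q : WithTop Γ) ≤ v (e (c • (w : MvPolynomial σ K)))
        rw [map_smul, Algebra.smul_def, v.map_mul]
        exact le_trans hw (le_add_of_nonneg_left (hK c)) }
  set S := {q : Γ | ∃ p : MvPolynomial σ K, p.totalDegree ≤ d ∧ v (e p) = (q : WithTop Γ)} with hS
  have hne : (U '' S).Nonempty :=
    ⟨U 0, 0, ⟨1, by simp, by rw [map_one, v.map_one]; rfl⟩, rfl⟩
  obtain ⟨_, ⟨m, hm, rfl⟩, hmin⟩ := WellFounded.has_min (wellFounded_lt (α := Submodule K W)) _ hne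
  refine ⟨m, hm, fun q hq => ?_⟩
  by_contra hlt
  rw [not_le] at hlt
  obtain ⟨p, hpd, hp⟩ := hm
  refine hmin (U q) ⟨q, hq, rfl⟩ (lt_of_le_of_ne (fun w hw => ?_) fun h => ?_)
  · exact le_trans (WithTop.coe_le_coe.2 hlt.le) hw
  · have : (⟨p, (MvPolynomial.mem_restrictTotalDegree σ d p).2 hpd⟩ : W) ∈ U m :=
      hp.symm.le
    rw [← h] at this
    have h2 : (q : WithTop Γ) ≤ v (e p) := this
    rw [hp, WithTop.coe_le_coe] at h2
    exact absurd h2 (not_le.2 hlt)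

/-- The values of the elements of a Noetherian ring satisfy the descending chain condition, so
they cannot fill an interval of `ℚ`. -/
theorem exists_gt_forall_val_ne {R : Type*} [CommRing R] [IsNoetherianRing R]
    {v : AddValuation L (WithTop ℚ)} (e : R →+* L) (he : ∀ r, 0 ≤ v (e r)) (M : ℚ) :
    ∃ q > M, ∀ r, v (e r) ≠ (q : WithTop ℚ) := by
  by_contra! hall
  let I : ℚ → Ideal R := fun q =>
    { carrier := {r | (q : WithTop ℚ) ≤ v (e r)}
      zero_mem' := by simp
      add_mem' := fun {a b} ha hb => by
        change (q : WithTop ℚ) ≤ v (e (a + b))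
        rw [map_add]
        exact v.map_le_add ha hb
      smul_mem' := fun c w hw => by
        change (q : WithTop ℚ) ≤ v (e (c * w))
        rw [map_mul, v.map_mul]
        exact le_trans hw (le_add_of_nonneg_left (he c)) }
  have hne : (I '' Set.Ioi M).Nonempty := ⟨I (M + 1), M + 1, by simp, rfl⟩
  obtain ⟨_, ⟨q, hq, rfl⟩, hmax⟩ := WellFounded.has_min (wellFounded_gt (α := Ideal R)) _ hne
  rw [Set.mem_Ioi] at hq
  obtain ⟨q', h1, h2⟩ := exists_between hq
  obtain ⟨r, hr⟩ := hall q' h1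
  refine hmax (I q') ⟨q', h1, rfl⟩ (lt_of_le_of_ne (fun w hw => ?_) fun h => ?_)
  · exact le_trans (WithTop.coe_le_coe.2 h2.le) hw
  · have : r ∈ I q' := hr.symm.le
    rw [← h] at this
    have h3 : (q : WithTop ℚ) ≤ v (e r) := this
    rw [hr, WithTop.coe_le_coe] at h3
    exact absurd h3 (not_le.2 h2)

/-- The coordinates of the point `(a, w)`. -/
abbrev snocPt {m : ℕ} (a : Fin m → L) (w : L) : Fin (m + 1) → L :=
  Fin.snoc (α := fun _ => L) a w

variable (K) in
/-- Polynomials in `m + 1` variables, as polynomials in the last variable. -/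
def lastVarEquiv (m : ℕ) :
    MvPolynomial (Fin (m + 1)) K ≃ₐ[K] Polynomial (MvPolynomial (Fin m) K) :=
  (MvPolynomial.renameEquiv K finSuccEquivLast).trans (MvPolynomial.optionEquivLeft K (Fin m))

theorem eval₂_lastVarEquiv {m : ℕ} (a : Fin m → L) (w : L) (p : MvPolynomial (Fin (m + 1)) K) :
    (lastVarEquiv K m p).eval₂ (MvPolynomial.aeval (R := K) a).toRingHom w =
      MvPolynomial.aeval (snocPt a w) p := by
  have hev : ((Polynomial.eval₂RingHom (MvPolynomial.aeval (R := K) a).toRingHom w).comp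
      (lastVarEquiv K m : _ →+* _)) = (MvPolynomial.aeval (R := K) (snocPt a w)).toRingHom := by
    refine MvPolynomial.ringHom_ext (fun c => ?_) fun i => ?_
    · simp [lastVarEquiv]
    · induction i using Fin.lastCases <;> simp [lastVarEquiv, snocPt]
  exact RingHom.congr_fun hev p

/-- A nonzero polynomial has finitely many roots in its last variable, at a generic point of the
other variables. -/
theorem finite_setOf_aeval_snoc_eq_zero {m : ℕ} {a : Fin m → L}
    (ha : Function.Injective (MvPolynomial.aeval (R := K) a)) {p : MvPolynomial (Fin (m + 1)) K}
    (hp : p ≠ 0) : {w : L | MvPolynomial.aeval (snocPt a w) p = 0}.Finite := by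
  have hmap : (lastVarEquiv K m p).map (MvPolynomial.aeval (R := K) a).toRingHom ≠ 0 :=
    (Polynomial.map_ne_zero_iff ha).2 ((map_ne_zero_iff _ (lastVarEquiv K m).injective).2 hp)
  refine (Polynomial.finite_setOfPred_isRoot hmap).subset fun w hw => ?_
  change Polynomial.eval w _ = 0
  rw [Polynomial.eval_map, eval₂_lastVarEquiv]
  exact hw

/-- If `z` is closer to `w i` than the values at `w i` of the polynomials of degree at most
`i + 1`, then every nonzero polynomial has at `z` the same finite value as at `w i`, for all large
`i`. -/
theorem eventually_val_aeval_eq (hK : TrivialOn K v) {m : ℕ} {a : Fin m → L}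
    (ha : Function.Injective (MvPolynomial.aeval (R := K) a)) (ha0 : ∀ i, 0 ≤ v (a i))
    {w : ℕ → L} {z : L} (hw : ∀ i, 0 ≤ v (w i)) (hz : 0 ≤ v z) (hinj : Function.Injective w)
    (h : ∀ i (p : MvPolynomial (Fin (m + 1)) K), p.totalDegree ≤ i + 1 →
      MvPolynomial.aeval (snocPt a (w i)) p ≠ 0 →
        v (MvPolynomial.aeval (snocPt a (w i)) p) < v (z - w i))
    {p : MvPolynomial (Fin (m + 1)) K} (hp : p ≠ 0) :
    ∃ N, ∀ i ≥ N, MvPolynomial.aeval (snocPt a (w i)) p ≠ 0 ∧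
      v (MvPolynomial.aeval (snocPt a z) p) = v (MvPolynomial.aeval (snocPt a (w i)) p) := by
  have hfin := (finite_setOf_aeval_snoc_eq_zero ha hp).preimage hinj.injOn
  obtain ⟨N, hN⟩ := hfin.bddAbove
  refine ⟨max (N + 1) p.totalDegree, fun i hi => ?_⟩
  have hi1 : N < i := lt_of_lt_of_le (Nat.lt_succ_self N) ((le_max_left _ _).trans hi)
  have hi2 : p.totalDegree ≤ i := (le_max_right _ _).trans hi
  have hne : MvPolynomial.aeval (snocPt a (w i)) p ≠ 0 := fun h0 => absurd (hN h0) (not_le.2 hi1)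
  refine ⟨hne, val_eq_of_lt_val_sub ((h i p (by omega) hne).trans_le ?_)⟩
  refine le_val_aeval_sub hK (fun j => ?_) (fun j => ?_) (fun j => ?_) p
  · induction j using Fin.lastCases <;> simp [snocPt, hz, ha0]
  · induction j using Fin.lastCases <;> simp [snocPt, hw, ha0]
  · induction j using Fin.lastCases <;> simp [snocPt]

end ValueSets

theorem algebraMap_hahnSeries (K : Type*) [Field K] (c : K) :
    algebraMap K (HahnSeries ℚ K) c = HahnSeries.C c := by
  rw [HahnSeries.algebraMap_apply']
  simp

theorem trivialOn_tVal (K : Type*) [Field K] : TrivialOn K (tVal K) := fun c => by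
  rw [HahnSeries.addVal_apply, algebraMap_hahnSeries]
  exact HahnSeries.orderTop_single_le

section Limits

variable {K : Type*} [Field K]

/-- Completeness of `K((t^ℚ))`: a sequence whose successive differences have strictly increasing
unbounded values has a limit. -/
theorem exists_limit {w : ℕ → HahnSeries ℚ K} {β : ℕ → ℚ} (hmono : StrictMono β)
    (hub : ∀ M, ∃ i, M < β i) (h : ∀ i, tVal K (w (i + 1) - w i) = (β i : WithTop ℚ)) :
    ∃ z : HahnSeries ℚ K, ∀ i, tVal K (z - w i) = (β i : WithTop ℚ) := by
  have hstab : ∀ i j, i ≤ j → ∀ q < β i, (w j).coeff q = (w i).coeff q := by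
    intro i j hij q hq
    induction j, hij using Nat.le_induction with
    | base => rfl
    | succ j hij ih =>
      rw [← ih, ← sub_eq_zero, ← HahnSeries.coeff_sub]
      apply HahnSeries.coeff_eq_zero_of_lt_orderTop
      rw [← HahnSeries.addVal_apply, h]
      exact WithTop.coe_lt_coe.2 (hq.trans_le (hmono.monotone hij))
  choose N hN using hub
  have hcoeff : ∀ i, ∀ q < β i, (w (N q)).coeff q = (w i).coeff q := by
    intro i q hq
    rcases le_total i (N q) with hi | hi
    · exact hstab i _ hi q hq
    · exact (hstab _ i hi q (hN q)).symm
  let z : HahnSeries ℚ K :=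
    { coeff := fun q => (w (N q)).coeff q
      isPWO_support' := by
        rw [Set.isPWO_iff_isWF, Set.isWF_iff_no_descending_seq]
        intro f hf hmem
        -- all terms of a descending sequence lie below the first, where `z` agrees with some `w i`
        refine (Set.isWF_iff_no_descending_seq.1 (w (N (f 0))).isWF_support) f hf fun n => ?_
        have hn : f n < β (N (f 0)) := (hf.antitone (Nat.zero_le n)).trans_lt (hN _)
        rw [HahnSeries.mem_support, ← hcoeff _ _ hn]
        exact hmem n }
  have hle : ∀ i, (β i : WithTop ℚ) ≤ tVal K (z - w i) := by
    intro i
    rw [HahnSeries.addVal_apply]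
    refine HahnSeries.le_orderTop_iff_forall.2 fun q hq => ?_
    rw [HahnSeries.coeff_sub, sub_eq_zero]
    exact hcoeff i q (WithTop.coe_lt_coe.1 hq)
  refine ⟨z, fun i => ?_⟩
  rw [← h i, ← sub_add_sub_cancel z (w (i + 1)) (w i)]
  refine AddValuation.map_add_eq_of_lt_right _ ?_
  rw [h i]
  exact (WithTop.coe_lt_coe.2 (hmono (Nat.lt_succ_self i))).trans_le (hle (i + 1))

end Limits

/-- Dependent choice along a recursion: the state `x` is updated by the chosen value `a`. -/
theorem exists_seq_of_step {X α : Type*} (step : X → α → X) (Inv : X → Prop)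
    (R : ℕ → X → α → Prop) (x₀ : X) (h₀ : Inv x₀)
    (h : ∀ n x, Inv x → ∃ a, R n x a ∧ Inv (step x a)) :
    ∃ (x : ℕ → X) (a : ℕ → α), x 0 = x₀ ∧ (∀ n, x (n + 1) = step (x n) (a n)) ∧
      (∀ n, Inv (x n)) ∧ ∀ n, R n (x n) (a n) := by
  choose c hc using fun (n : ℕ) (x : {x // Inv x}) => h n x.1 x.2
  let y : ℕ → {x // Inv x} := fun n =>
    Nat.rec ⟨x₀, h₀⟩ (fun k x => ⟨step x.1 (c k x), (hc k x).2⟩) n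
  exact ⟨fun n => (y n).1, fun n => c n (y n), rfl, fun n => rfl, fun n => (y n).2,
    fun n => (hc n (y n)).1⟩

/-! ### An embedding with value group `ℚ` -/

section PolynomialValues

variable {L : Type*} [Field L] {v : AddValuation L (WithTop ℚ)}

theorem exists_le_val_eval (p : Polynomial L) :
    ∃ m : ℚ, ∀ r, 0 ≤ v r → (m : WithTop ℚ) ≤ v (p.eval r) := by
  induction p using Polynomial.induction_on' with
  | add p q hp hq =>
    obtain ⟨m, hm⟩ := hp
    obtain ⟨n, hn⟩ := hq
    refine ⟨min m n, fun r hr => ?_⟩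
    rw [Polynomial.eval_add]
    exact v.map_le_add (le_trans (WithTop.coe_le_coe.2 (min_le_left _ _)) (hm r hr))
      (le_trans (WithTop.coe_le_coe.2 (min_le_right _ _)) (hn r hr))
  | monomial k c =>
    obtain ⟨m, hm⟩ : ∃ m : ℚ, (m : WithTop ℚ) ≤ v c := by
      cases h : v c with
      | top => exact ⟨0, le_top⟩
      | coe q => exact ⟨q, le_rfl⟩
    refine ⟨m, fun r hr => ?_⟩
    rw [Polynomial.eval_monomial, v.map_mul, v.map_pow]
    exact hm.trans (le_add_of_nonneg_right (nsmul_nonneg hr k))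

/-- Near `0`, the value of a polynomial vanishing at `0` is that of its lowest term. -/
theorem exists_val_eval_eq {Q : Polynomial L} (hQ : Q ≠ 0) (h0 : Q.eval 0 = 0) :
    ∃ (k : ℕ) (c M : ℚ), 0 < k ∧ ∀ (r : L) (ρ : ℚ), v r = (ρ : WithTop ℚ) → M < ρ →
      v (Q.eval r) = ((k * ρ + c : ℚ) : WithTop ℚ) := by
  obtain ⟨q, hq, hdvd⟩ := Polynomial.exists_eq_pow_rootMultiplicity_mul_and_not_dvd Q hQ 0
  have hk : 0 < Q.rootMultiplicity 0 := (Polynomial.rootMultiplicity_pos hQ).2 h0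
  set k := Q.rootMultiplicity 0
  rw [Polynomial.dvd_iff_isRoot] at hdvd
  obtain ⟨c, hc⟩ : ∃ c : ℚ, v (q.eval 0) = (c : WithTop ℚ) := by
    have : v (q.eval 0) ≠ ⊤ := fun h => hdvd ((AddValuation.top_iff v).1 h)
    exact ⟨_, (WithTop.coe_untop _ this).symm⟩
  obtain ⟨m, hm⟩ := exists_le_val_eval (v := v) q.divX
  refine ⟨k, c, max 0 (c - m), hk, fun r ρ hr hρ => ?_⟩
  have hρ0 : 0 < ρ := (le_max_left _ _).trans_lt hρ
  have hρ1 : c - m < ρ := (le_max_right _ _).trans_lt hρ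
  have hr0 : 0 ≤ v r := by rw [hr]; exact WithTop.coe_le_coe.2 hρ0.le
  have hqr : v (q.eval r) = c := by
    rw [← hc]
    refine val_eq_of_lt_val_sub ?_
    have : q.eval r - q.eval 0 = q.divX.eval r * r := by
      have h := congrArg (Polynomial.eval r) (Polynomial.divX_mul_X_add q)
      rw [Polynomial.eval_add, Polynomial.eval_mul, Polynomial.eval_X, Polynomial.eval_C,
        Polynomial.coeff_zero_eq_eval_zero] at h
      rw [← h, add_sub_cancel_right]
    rw [this, v.map_mul, hc, hr]
    refine lt_of_lt_of_le ?_ (add_le_add_left (hm r hr0) _)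
    rw [← WithTop.coe_add]
    exact WithTop.coe_lt_coe.2 (by linarith)
  rw [hq, Polynomial.eval_mul, v.map_mul, hqr, Polynomial.eval_pow, v.map_pow]
  simp only [map_zero, sub_zero, Polynomial.eval_X, hr]
  rw [← WithTop.coe_nsmul, ← WithTop.coe_add, nsmul_eq_mul]

end PolynomialValues

section ValueGroup

variable {L : Type*} [Field L]

/-- A valuation which takes all the values `1 / (n + 1)` has value group `ℚ`. -/
theorem hasValueGroup_of_inv {v : AddValuation L (WithTop ℚ)}
    (h : ∀ n : ℕ, ∃ f, v f = ((1 / (n + 1) : ℚ) : WithTop ℚ)) : HasValueGroup v := by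
  have hpos : ∀ (m : ℕ) (n : ℕ), ∃ f, v f = ((m / (n + 1) : ℚ) : WithTop ℚ) := by
    intro m n
    obtain ⟨f, hf⟩ := h n
    refine ⟨f ^ m, ?_⟩
    rw [v.map_pow, hf, ← WithTop.coe_nsmul, nsmul_eq_mul, mul_one_div]
  intro γ
  obtain ⟨n, hn⟩ : ∃ n : ℕ, γ.den = n + 1 := ⟨γ.den - 1, by have := γ.pos; omega⟩
  have hγ : γ = (γ.num : ℚ) / (n + 1) := by
    conv_lhs => rw [← Rat.num_div_den γ, hn]
    push_cast; rfl
  rcases Int.eq_nat_or_neg γ.num with ⟨m, hm | hm⟩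
  · obtain ⟨f, hf⟩ := hpos m n
    refine ⟨f, ?_⟩
    rw [hf, hγ, hm]; rfl
  · obtain ⟨f, hf⟩ := hpos m n
    have hf0 : f ≠ 0 := by
      rintro rfl
      rw [v.map_zero] at hf
      exact WithTop.top_ne_coe hf
    refine ⟨f⁻¹, ?_⟩
    have h1 : v f⁻¹ ≠ ⊤ := (AddValuation.ne_top_iff v).2 (inv_ne_zero hf0)
    obtain ⟨q, hq⟩ := WithTop.ne_top_iff_exists.1 h1
    have h2 : v f⁻¹ + v f = 0 := by rw [← v.map_mul, inv_mul_cancel₀ hf0, v.map_one]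
    rw [← hq, hf, ← WithTop.coe_add, ← WithTop.coe_zero, WithTop.coe_inj] at h2
    rw [← hq, hγ, hm, WithTop.coe_inj]
    push_cast
    rw [neg_div]
    linarith

end ValueGroup

section Embedding

variable (K : Type*) [Field K]

/-- The series `t`. -/
def tSeries : HahnSeries ℚ K := HahnSeries.single 1 1

theorem tVal_single (q : ℚ) : tVal K (HahnSeries.single q 1) = (q : WithTop ℚ) := by
  rw [HahnSeries.addVal_apply, HahnSeries.orderTop_single one_ne_zero]

theorem aeval_tSeries_injective :
    Function.Injective (MvPolynomial.aeval (R := K) ![tSeries K]) := by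
  have h : AlgebraicIndependent K ![tSeries K] := by
    rw [algebraicIndependent_unique_type_iff, transcendental_iff_injective]
    have : (Polynomial.aeval (R := K) (tSeries K)).toRingHom =
        (HahnSeries.ofPowerSeries ℚ K).comp (Polynomial.coeToPowerSeries.ringHom) := by
      refine Polynomial.ringHom_ext (fun c => ?_) ?_
      · simp [algebraMap_hahnSeries]
      · simp [tSeries]
    intro p q hpq
    have h2 : (Polynomial.aeval (R := K) (tSeries K)).toRingHom p =
      (Polynomial.aeval (R := K) (tSeries K)).toRingHom q := hpq
    rw [this] at h2
    exact Polynomial.coe_injective K (HahnSeries.ofPowerSeries_injective h2)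
  exact h

/-- The field `K(t)` in `K((t^ℚ))`. -/
abbrev tField : IntermediateField K (HahnSeries ℚ K) := IntermediateField.adjoin K {tSeries K}

theorem tSeries_mem_tField : tSeries K ∈ tField K :=
  IntermediateField.subset_adjoin K _ (Set.mem_singleton _)

theorem isAlgebraic_single {q : ℚ} (hq : 0 < q) :
    IsAlgebraic (tField K) (HahnSeries.single q (1 : K)) := by
  refine IsAlgebraic.of_pow (n := q.den) q.pos ?_
  have : (HahnSeries.single q (1 : K)) ^ q.den = tSeries K ^ q.num.toNat := by
    rw [tSeries, HahnSeries.single_pow, HahnSeries.single_pow, one_pow, one_pow]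
    have h : (q.num : ℚ) = (q.num.toNat : ℚ) := by
      exact_mod_cast (Int.toNat_of_nonneg (Rat.num_pos.2 hq).le).symm
    rw [nsmul_eq_mul, nsmul_eq_mul, mul_one, mul_comm, Rat.mul_den_eq_num, h]
  rw [this]
  exact isAlgebraic_algebraMap (⟨_, pow_mem (tSeries_mem_tField K) _⟩ : tField K)

variable {K}

/-- If `w` is algebraic over `K(t)`, there are arbitrarily large `e` such that any field containing
`t` and a series `y` with `y - w` of value `e` has elements of value `γ`: namely `P(y) / t^N`, where
`P` is a polynomial over `K(t)` which vanishes at `w`. -/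
theorem exists_exponent {w : HahnSeries ℚ K} (hw : IsAlgebraic (tField K) w) (γ B : ℚ) :
    ∃ e > B, ∀ y, tVal K (y - w) = (e : WithTop ℚ) → ∀ E : IntermediateField K (HahnSeries ℚ K),
      tSeries K ∈ E → y ∈ E → ∃ f ∈ E, tVal K f = (γ : WithTop ℚ) := by
  obtain ⟨P, hP, hPw⟩ := hw
  set P' : Polynomial (HahnSeries ℚ K) := P.map (algebraMap (tField K) (HahnSeries ℚ K)) with hP'
  have hP'0 : P' ≠ 0 := (Polynomial.map_ne_zero_iff (algebraMap (tField K) _).injective).2 hP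
  have hQ : Polynomial.taylor w P' ≠ 0 := (Polynomial.taylor_eq_zero _ _).not.2 hP'0
  have hQ0 : (Polynomial.taylor w P').eval 0 = 0 := by
    rw [Polynomial.taylor_eval, zero_add, hP', Polynomial.eval_map]
    exact hPw
  obtain ⟨k, c, M, hk, hval⟩ := exists_val_eval_eq (v := tVal K) hQ hQ0
  have hk0 : (0 : ℚ) < k := Nat.cast_pos.2 hk
  obtain ⟨N, hN⟩ := exists_nat_gt (k * max M B + c - γ)
  have hbig : max M B < (γ - c + N) / k := by
    rw [lt_div_iff₀ hk0]; linarith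
  refine ⟨(γ - c + N) / k, (le_max_right _ _).trans_lt hbig, fun y hy E ht hyE => ?_⟩
  have h1 := hval _ _ hy ((le_max_left _ _).trans_lt hbig)
  rw [Polynomial.taylor_eval, sub_add_cancel, mul_div_cancel₀ _ hk0.ne'] at h1
  have hE : tField K ≤ E := by
    rw [IntermediateField.adjoin_le_iff]
    simpa using ht
  refine ⟨P'.eval y * (HahnSeries.single (-N : ℚ) 1), mul_mem ?_ ?_, ?_⟩
  · rw [hP', Polynomial.eval_map, Polynomial.eval₂_eq_sum_range]
    exact sum_mem fun i _ => mul_mem (hE (P.coeff i).2) (pow_mem hyE i)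
  · have : HahnSeries.single (-N : ℚ) (1 : K) = (tSeries K ^ N)⁻¹ := by
      rw [tSeries, HahnSeries.single_pow, one_pow, eq_comm]
      refine inv_eq_of_mul_eq_one_left ?_
      rw [HahnSeries.single_mul_single, nsmul_eq_mul]
      simp
    rw [this]
    exact inv_mem (pow_mem ht N)
  · rw [AddValuation.map_mul, h1, tVal_single, ← WithTop.coe_add, WithTop.coe_inj]
    ring

/-- There is a series `y` such that `K[t, y]` is a polynomial ring, whose fraction field has
value group `ℚ`. It is a sum `∑ t ^ e n`, each exponent being chosen in terms of the previous ones
so that an element of value `1 / (n + 1)` appears, and large enough for the sum to be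
transcendental. -/
theorem exists_generic_series : ∃ y : HahnSeries ℚ K, 0 < tVal K y ∧
    Function.Injective (MvPolynomial.aeval (R := K) (snocPt ![tSeries K] y)) ∧
    ∀ E : IntermediateField K (HahnSeries ℚ K), tSeries K ∈ E → y ∈ E →
      ∀ n : ℕ, ∃ f ∈ E, tVal K f = ((1 / (n + 1) : ℚ) : WithTop ℚ) := by
  obtain ⟨x, e, hx0, hstep, hInv, hR⟩ := exists_seq_of_step
    (X := HahnSeries ℚ K × ℚ) (α := ℚ)
    (fun x e => (x.1 + HahnSeries.single e 1, e))
    (fun x => IsAlgebraic (tField K) x.1 ∧ 0 < tVal K x.1 ∧ 0 ≤ x.2)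
    (fun n x e => x.2 < e ∧ (n : ℚ) < e ∧
      (∀ p : MvPolynomial (Fin 2) K, p.totalDegree ≤ n + 1 →
        MvPolynomial.aeval (snocPt ![tSeries K] x.1) p ≠ 0 →
          tVal K (MvPolynomial.aeval (snocPt ![tSeries K] x.1) p) < (e : WithTop ℚ)) ∧
      ∀ y, tVal K (y - x.1) = (e : WithTop ℚ) → ∀ E : IntermediateField K (HahnSeries ℚ K),
        tSeries K ∈ E → y ∈ E → ∃ f ∈ E, tVal K f = ((1 / (n + 1) : ℚ) : WithTop ℚ))
    (0, 0) ⟨isAlgebraic_zero, by rw [AddValuation.map_zero]; exact WithTop.coe_lt_top 0, le_rfl⟩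
    (by
      rintro n ⟨w, B⟩ ⟨halg, hpos, hB⟩
      obtain ⟨τ, hτ⟩ := exists_isGreatest_val (trivialOn_tVal K)
        (MvPolynomial.aeval (snocPt ![tSeries K] w)) (n + 1)
      obtain ⟨e, he, hE⟩ := exists_exponent halg (1 / (n + 1)) (max B (max n τ))
      have he0 : B < e := (le_max_left _ _).trans_lt he
      have he1 : (n : ℚ) < e := ((le_max_left _ _).trans (le_max_right _ _)).trans_lt he
      have he2 : τ < e := ((le_max_right _ _).trans (le_max_right _ _)).trans_lt he
      have hepos : 0 < e := lt_of_le_of_lt hB he0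
      refine ⟨e, ⟨he0, he1, fun p hp hne => ?_, hE⟩, halg.add (isAlgebraic_single K hepos),
        AddValuation.map_lt_add _ hpos ?_, hepos.le⟩
      · obtain ⟨q, hq⟩ := WithTop.ne_top_iff_exists.1 ((AddValuation.ne_top_iff (tVal K)).2 hne)
        rw [← hq]
        exact WithTop.coe_lt_coe.2 ((hτ.2 ⟨p, hp, hq.symm⟩).trans_lt he2)
      · rw [tVal_single]
        exact WithTop.coe_lt_coe.2 hepos)
  have hmono : StrictMono e := strictMono_nat_of_lt_succ fun n => by
    have := (hR (n + 1)).1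
    rwa [hstep n] at this
  obtain ⟨y, hy⟩ := exists_limit (w := fun n => (x n).1) hmono
    (fun M => by
      obtain ⟨n, hn⟩ := exists_nat_gt M
      exact ⟨n, hn.trans (hR n).2.1⟩)
    (fun n => by
      rw [hstep n, add_sub_cancel_left, tVal_single])
  have hinj : Function.Injective fun n => (x n).1 := fun i j hij => by
    have h1 := hy i
    dsimp only at hij
    rw [hij, hy j, WithTop.coe_inj] at h1
    exact (hmono.injective h1).symm
  have hy0 : 0 < tVal K y := by
    have := hy 0
    rw [hx0, sub_zero] at this
    rw [this]
    have h1 := (hR 0).2.1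
    exact WithTop.coe_lt_coe.2 (by simpa using h1)
  refine ⟨y, hy0, ?_, fun E ht hyE n => (hR n).2.2.2 y (hy n) E ht hyE⟩
  rw [injective_iff_map_eq_zero]
  intro p hp
  by_contra hne
  obtain ⟨N, hN⟩ := eventually_val_aeval_eq (trivialOn_tVal K) (aeval_tSeries_injective K)
    (fun i => by
      rw [Subsingleton.elim i 0]
      change 0 ≤ tVal K (tSeries K)
      rw [tSeries, tVal_single]
      exact WithTop.coe_le_coe.2 zero_le_one)
    (fun n => (hInv n).2.1.le) hy0.le hinj
    (fun n q hq hq0 => by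
      rw [hy n]
      exact (hR n).2.2.1 q hq hq0) hne
  obtain ⟨h1, h2⟩ := hN N le_rfl
  rw [hp, AddValuation.map_zero] at h2
  exact h1 ((AddValuation.top_iff _).1 h2.symm)

variable (K) in
theorem exists_isAdmissible :
    ∃ ι : FunField (Fin 2) K →ₐ[K] HahnSeries ℚ K, IsAdmissible ι := by
  obtain ⟨y, hy0, hinj, hE⟩ := exists_generic_series (K := K)
  set ι := liftFun _ hinj with hι
  have hX0 : ι (ratFun (MvPolynomial.X 0)) = tSeries K := by
    rw [hι, liftFun_ratFun, MvPolynomial.aeval_X]; rfl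
  have hX1 : ι (ratFun (MvPolynomial.X 1)) = y := by
    rw [hι, liftFun_ratFun, MvPolynomial.aeval_X]; rfl
  refine ⟨ι, ?_, ?_⟩
  · refine dominates_locRing (trivialOn_tVal K)
      (ι.comp (IsScalarTower.toAlgHom K (LocRing (Fin 2) K) (FunField (Fin 2) K))) ?_ fun i => ?_
    · exact ι.toRingHom.injective.comp
        (IsFractionRing.injective (LocRing (Fin 2) K) (FunField (Fin 2) K))
    · change 0 < tVal K (ι (ratFun (MvPolynomial.X i)))
      fin_cases i
      · change 0 < tVal K (ι (ratFun (MvPolynomial.X 0)))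
        rw [hX0, tSeries, tVal_single]
        exact WithTop.coe_lt_coe.2 zero_lt_one
      · change 0 < tVal K (ι (ratFun (MvPolynomial.X 1)))
        rwa [hX1]
  · refine hasValueGroup_of_inv fun n => ?_
    obtain ⟨f, ⟨r, rfl⟩, hf⟩ := hE ι.fieldRange ⟨_, hX0⟩ ⟨_, hX1⟩ n
    exact ⟨r, hf⟩

end Embedding

/-! ### Dimension of the local ring at the origin -/

section Dimension

variable (K : Type*) [Field K]

/-- The substitution `X_i ↦ 0` for `i < k`. -/
def killVars (n k : ℕ) : MvPolynomial (Fin n) K →ₐ[K] MvPolynomial (Fin n) K :=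
  MvPolynomial.aeval fun i => if (i : ℕ) < k then 0 else MvPolynomial.X i

/-- The kernels of these substitutions form a chain of prime ideals. -/
theorem le_height_ker_killVars (n k : ℕ) (hk : k ≤ n) :
    (k : ℕ∞) ≤ (RingHom.ker (killVars K n k)).height := by
  induction k with
  | zero => simp
  | succ k ih =>
    have h1 := ih (Nat.le_of_succ_le hk)
    have : (RingHom.ker (killVars K n k)).IsPrime := RingHom.ker_isPrime _
    have : (RingHom.ker (killVars K n (k + 1))).IsPrime := RingHom.ker_isPrime _
    have hcomp : (killVars K n (k + 1)).comp (killVars K n k) = killVars K n (k + 1) := by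
      refine MvPolynomial.algHom_ext fun i => ?_
      by_cases hi : (i : ℕ) < k
      · simp [killVars, hi, hi.le]
      · simp [killVars, hi]
    have hlt : RingHom.ker (killVars K n k) < RingHom.ker (killVars K n (k + 1)) := by
      refine lt_of_le_of_ne (fun p hp => ?_) fun h => ?_
      · rw [RingHom.mem_ker] at hp ⊢
        rw [← hcomp, AlgHom.comp_apply, hp, map_zero]
      · have hX : (MvPolynomial.X ⟨k, hk⟩ : MvPolynomial (Fin n) K) ∈
            RingHom.ker (killVars K n (k + 1)) := by
          simp [RingHom.mem_ker, killVars]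
        rw [← h, RingHom.mem_ker] at hX
        simp [killVars] at hX
    rw [Nat.cast_succ]
    exact (add_le_add_left h1 1).trans (Ideal.height_add_one_le_of_lt_of_isPrime hlt)

/-- The local ring of affine `n`-space at the origin has dimension `n`: the origin has height at
least `n` by the chain of kernels above, and at most the dimension of the polynomial ring. -/
theorem ringKrullDim_locRing (n : ℕ) : ringKrullDim (LocRing (Fin n) K) = n := by
  rw [IsLocalization.AtPrime.ringKrullDim_eq_height (MvPolynomial.idealOfVars (Fin n) K)]
  refine le_antisymm ?_ ?_
  · refine Ideal.height_le_ringKrullDim_of_isPrime.trans ?_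
    rw [MvPolynomial.ringKrullDim_of_isNoetherianRing]
    simp
  · have h : RingHom.ker (killVars K n n) ≤ MvPolynomial.idealOfVars (Fin n) K := by
      intro p hp
      rw [mem_idealOfVars_iff]
      have h0 : (killVars K n n : MvPolynomial (Fin n) K →+* MvPolynomial (Fin n) K) =
          MvPolynomial.C.comp MvPolynomial.constantCoeff := by
        refine MvPolynomial.ringHom_ext (fun c => ?_) fun i => ?_ <;> simp [killVars]
      have h1 : killVars K n n p = MvPolynomial.C (MvPolynomial.constantCoeff p) :=
        RingHom.congr_fun h0 p
      rw [RingHom.mem_ker, h1] at hp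
      simpa using hp
    have := (le_height_ker_killVars K n n le_rfl).trans (Ideal.height_mono h)
    exact_mod_cast this

end Dimension

/-! ### Admissible embeddings and the inductive construction -/

section Admissible

variable {K : Type*} [Field K] {ι : FunField (Fin 2) K →ₐ[K] HahnSeries ℚ K}

/-- The images of `x` and `y`. -/
abbrev xyPt (ι : FunField (Fin 2) K →ₐ[K] HahnSeries ℚ K) : Fin 2 → HahnSeries ℚ K :=
  ![ι (ratFun (MvPolynomial.X 0)), ι (ratFun (MvPolynomial.X 1))]

theorem aeval_xyPt (p : MvPolynomial (Fin 2) K) :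
    MvPolynomial.aeval (xyPt ι) p = ι (ratFun p) := by
  have : MvPolynomial.aeval (xyPt ι) =
      ι.comp (IsScalarTower.toAlgHom K (MvPolynomial (Fin 2) K) (FunField (Fin 2) K)) := by
    refine MvPolynomial.algHom_ext fun i => ?_
    rw [MvPolynomial.aeval_X]
    fin_cases i <;> rfl
  rw [this]; rfl

theorem aeval_xyPt_injective : Function.Injective (MvPolynomial.aeval (R := K) (xyPt ι)) := by
  intro p q hpq
  rw [aeval_xyPt, aeval_xyPt] at hpq
  exact ratFun_injective (ι.toRingHom.injective hpq)

theorem evalZ_eq (w : HahnSeries ℚ K) : evalZ ι w = MvPolynomial.aeval (snocPt (xyPt ι) w) := by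
  refine MvPolynomial.algHom_ext fun i => ?_
  rw [evalZ, MvPolynomial.aeval_X, MvPolynomial.aeval_X]
  fin_cases i <;> rfl

theorem IsAdmissible.X_pos (hι : IsAdmissible ι) (i : Fin 2) :
    0 < tVal K (ι (ratFun (MvPolynomial.X i))) := by
  refine ((hι.1.2.2 (algebraMap _ _ (MvPolynomial.X i))).2).1 ?_
  rw [mem_nonunits_iff, isUnit_algebraMap_locRing]
  simp

theorem IsAdmissible.xyPt_pos (hι : IsAdmissible ι) (i : Fin 2) : 0 < tVal K (xyPt ι i) := by
  fin_cases i
  · exact hι.X_pos 0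
  · exact hι.X_pos 1

theorem IsAdmissible.evalZ_X_pos (hι : IsAdmissible ι) {w : HahnSeries ℚ K} (hw : 0 < tVal K w)
    (i : Fin 3) : 0 < tVal K (evalZ ι w (MvPolynomial.X i)) := by
  rw [evalZ_eq, MvPolynomial.aeval_X]
  induction i using Fin.lastCases with
  | last => rwa [snocPt, Fin.snoc_last]
  | cast i => rw [snocPt, Fin.snoc_castSucc]; exact hι.xyPt_pos i

theorem IsAdmissible.evalZ_nonneg (hι : IsAdmissible ι) {w : HahnSeries ℚ K} (hw : 0 < tVal K w)
    (p : MvPolynomial (Fin 3) K) : 0 ≤ tVal K (evalZ ι w p) :=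
  val_nonneg (trivialOn_tVal K) _ (hι.evalZ_X_pos hw) p

theorem IsAdmissible.val_evalZ_div (hι : IsAdmissible ι) {w : HahnSeries ℚ K} (hw : 0 < tVal K w)
    (a : MvPolynomial (Fin 3) K) {s : MvPolynomial (Fin 3) K}
    (hs : MvPolynomial.constantCoeff s ≠ 0) :
    tVal K (evalZ ι w a / evalZ ι w s) = tVal K (evalZ ι w a) := by
  have hs0 : tVal K (evalZ ι w s) = 0 :=
    val_eq_zero (trivialOn_tVal K) _ (hι.evalZ_X_pos hw) hs
  have hne : evalZ ι w s ≠ 0 := fun h => by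
    rw [h, AddValuation.map_zero] at hs0
    exact WithTop.top_ne_zero hs0
  conv_rhs => rw [← div_mul_cancel₀ (evalZ ι w a) hne, AddValuation.map_mul, hs0, add_zero]

theorem IsAdmissible.mem_locValues_iff (hι : IsAdmissible ι) {w : HahnSeries ℚ K}
    (hw : 0 < tVal K w) (q : ℚ) :
    q ∈ locValues ι w ↔ ∃ p, tVal K (evalZ ι w p) = (q : WithTop ℚ) := by
  constructor
  · rintro ⟨_, ⟨a, s, hs, rfl⟩, h⟩
    exact ⟨a, by rw [← hι.val_evalZ_div hw a hs, h]⟩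
  · rintro ⟨p, hp⟩
    exact ⟨evalZ ι w p, ⟨p, 1, by simp, by simp⟩, hp⟩

theorem degreeOf_rename_castSucc (p : MvPolynomial (Fin 2) K) :
    MvPolynomial.degreeOf 2 (MvPolynomial.rename (Fin.castSucc : Fin 2 → Fin 3) p) = 0 := by
  classical
  rw [MvPolynomial.degreeOf_def, Multiset.count_eq_zero]
  intro hmem
  obtain ⟨i, -, hi⟩ := Multiset.mem_map.1 (MvPolynomial.degrees_rename _ _ hmem)
  exact absurd hi (Fin.castSucc_lt_last i).ne

theorem evalZ_rename (w : HahnSeries ℚ K) (p : MvPolynomial (Fin 2) K) :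
    evalZ ι w (MvPolynomial.rename Fin.castSucc p) = ι (ratFun p) := by
  rw [← aeval_xyPt, evalZ_eq, MvPolynomial.aeval_rename]
  congr 2
  funext i
  simp only [Function.comp_apply, snocPt, Fin.snoc_castSucc]

theorem IsAdmissible.mem_F0_iff (hι : IsAdmissible ι) (q : ℚ) :
    q ∈ F0 ι ↔ ∃ p : MvPolynomial (Fin 2) K, tVal K (ι (ratFun p)) = (q : WithTop ℚ) := by
  constructor
  · rintro ⟨a, ha⟩
    obtain ⟨p, -, hp⟩ := exists_val_locRing_eq (trivialOn_tVal K)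
      (ι.comp (IsScalarTower.toAlgHom K (LocRing (Fin 2) K) (FunField (Fin 2) K)))
      (fun i => hι.X_pos i) a
    exact ⟨p, hp.symm.trans ha⟩
  · rintro ⟨p, hp⟩
    exact ⟨algebraMap _ _ p, hp⟩

theorem IsAdmissible.add_mem_locValues (hι : IsAdmissible ι) {w : HahnSeries ℚ K}
    (hw : 0 < tVal K w) {a b : ℚ} (ha : a ∈ F0 ι) (hb : b ∈ locValues ι w) :
    a + b ∈ locValues ι w := by
  rw [hι.mem_locValues_iff hw] at hb ⊢
  rw [hι.mem_F0_iff] at ha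
  obtain ⟨p, hp⟩ := ha
  obtain ⟨q, hq⟩ := hb
  refine ⟨MvPolynomial.rename Fin.castSucc p * q, ?_⟩
  rw [map_mul, AddValuation.map_mul, evalZ_rename, hp, hq]; rfl

theorem exists_coe_val_ratFun {p : MvPolynomial (Fin 2) K} (hp : p ≠ 0) :
    ∃ q : ℚ, val2 ι (ratFun p) = (q : WithTop ℚ) := by
  have h : val2 ι (ratFun p) ≠ ⊤ :=
    (AddValuation.ne_top_iff _).2 (ratFun_ne_zero.2 hp)
  exact ⟨_, (WithTop.coe_untop _ h).symm⟩

/-- The construction can be carried out: the semigroup of values of the Noetherian ring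
`K[x, y, z_i]` leaves room for arbitrarily large `lam i`, and every rational number is the value of
a fraction `f i / g i`. -/
theorem IsAdmissible.exists_construction (hι : IsAdmissible ι) :
    ∃ (lam alpha tau : ℕ → ℚ) (f g : ℕ → MvPolynomial (Fin 2) K),
      IsConstruction ι lam alpha tau f g := by
  obtain ⟨x, c, hx0, hstep, hInv, hR⟩ := exists_seq_of_step
    (X := FunField (Fin 2) K × MvPolynomial (Fin 2) K × ℚ)
    (α := (ℚ × ℚ × ℚ) × MvPolynomial (Fin 2) K × MvPolynomial (Fin 2) K)
    (fun x c => (x.1 + ratFun c.2.1 / ratFun c.2.2, x.2.1 * c.2.2, c.1.1))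
    (fun x => 0 < val2 ι x.1 ∧ x.2.1 ≠ 0)
    (fun n x c => (0 < c.1.1 ∧ 0 < c.1.2.1 ∧ 0 < c.1.2.2) ∧ c.2.2 ≠ 0 ∧
      IsGreatest {q : ℚ | ∃ p : MvPolynomial (Fin 3) K, p.totalDegree ≤ n + 1 ∧
        tVal K (evalZ ι (ι x.1) p) = (q : WithTop ℚ)} c.1.2.2 ∧
      c.1.1 ∉ locValues ι (ι x.1) ∧
      (c.1.2.2 : WithTop ℚ) + val2 ι (ratFun x.2.1) < (c.1.1 : WithTop ℚ) ∧
      (x.2.2 : WithTop ℚ) + val2 ι (ratFun x.2.1) < (c.1.1 : WithTop ℚ) ∧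
      (c.1.2.1 : WithTop ℚ) + val2 ι (ratFun x.2.1) = (c.1.1 : WithTop ℚ) ∧
      val2 ι (ratFun c.2.1 / ratFun c.2.2) = (c.1.2.1 : WithTop ℚ))
    (0, 1, 0) ⟨by rw [AddValuation.map_zero]; exact WithTop.coe_lt_top 0, one_ne_zero⟩
    (by
      rintro n ⟨r, G, B⟩ ⟨hr, hG⟩
      obtain ⟨q, hq⟩ := exists_coe_val_ratFun (ι := ι) hG
      have hq0 : 0 ≤ q := by
        have h1 : 0 ≤ tVal K (ι (ratFun G)) := by
          rw [← aeval_xyPt]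
          exact val_nonneg (trivialOn_tVal K) _
            (fun i => by rw [MvPolynomial.aeval_X]; exact hι.xyPt_pos i) G
        have h2 : tVal K (ι (ratFun G)) = (q : WithTop ℚ) := hq
        rw [h2] at h1
        exact WithTop.coe_le_coe.1 h1
      obtain ⟨τ, hτ⟩ := exists_isGreatest_val (trivialOn_tVal K) (evalZ ι (ι r)) (n + 1)
      have hτ0 : 0 < τ := by
        obtain ⟨s, hs⟩ := exists_coe_val_ratFun (ι := ι)
          (MvPolynomial.X_ne_zero (R := K) (0 : Fin 2))
        have hs' : tVal K (ι (ratFun (MvPolynomial.X 0))) = (s : WithTop ℚ) := hs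
        have hpos := hι.X_pos 0
        rw [hs'] at hpos
        refine (WithTop.coe_lt_coe.1 hpos).trans_le (hτ.2 ⟨MvPolynomial.X 0, ?_, ?_⟩)
        · rw [MvPolynomial.totalDegree_X]; omega
        · rw [evalZ, MvPolynomial.aeval_X]; exact hs'
      obtain ⟨lam, hlam, hnot⟩ := exists_gt_forall_val_ne (v := tVal K)
        (evalZ ι (ι r) : MvPolynomial (Fin 3) K →+* HahnSeries ℚ K)
        (hι.evalZ_nonneg hr) (max (τ + q) (B + q))
      have h1 : τ + q < lam := (le_max_left _ _).trans_lt hlam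
      have h2 : B + q < lam := (le_max_right _ _).trans_lt hlam
      obtain ⟨s, hs⟩ := hι.2 (lam - q)
      obtain ⟨f, g, hg, rfl⟩ := exists_ratFun_div s
      refine ⟨((lam, lam - q, τ), f, g), ⟨⟨?_, ?_, hτ0⟩, hg, hτ, ?_, ?_, ?_, ?_, hs⟩, ?_, ?_⟩
      · dsimp only; linarith
      · dsimp only; linarith
      · exact (hι.mem_locValues_iff hr lam).not.2 fun ⟨p, hp⟩ => hnot p hp
      · rw [hq, ← WithTop.coe_add]; exact WithTop.coe_lt_coe.2 h1
      · rw [hq, ← WithTop.coe_add]; exact WithTop.coe_lt_coe.2 h2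
      · rw [hq, ← WithTop.coe_add, sub_add_cancel]
      · refine AddValuation.map_lt_add _ hr ?_
        dsimp only
        rw [hs]
        exact WithTop.coe_lt_coe.2 (by linarith)
      · exact mul_ne_zero hG hg)
  have hsum : ∀ n, (x n).1 = ∑ j ∈ Finset.range n, ratFun (c j).2.1 / ratFun (c j).2.2 := by
    intro n
    induction n with
    | zero => rw [hx0]; rfl
    | succ n ih => rw [hstep, Finset.sum_range_succ, ih]
  have hprod : ∀ n, (x n).2.1 = ∏ j ∈ Finset.range n, (c j).2.2 := by
    intro n
    induction n with
    | zero => rw [hx0]; rfl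
    | succ n ih => rw [hstep, Finset.prod_range_succ, ih]
  have hpz : ∀ n, partialZ ι (fun j => (c j).2.1) (fun j => (c j).2.2) n = ι (x n).1 := by
    intro n; rw [hsum]; rfl
  have hpv : ∀ n, prodVal ι (fun j => (c j).2.2) n = val2 ι (ratFun (x n).2.1) := by
    intro n; rw [hprod]; rfl
  refine ⟨fun n => (c n).1.1, fun n => (c n).1.2.1, fun n => (c n).1.2.2, fun n => (c n).2.1,
    fun n => (c n).2.2, ?_⟩
  refine ⟨fun n => (hR n).1, fun n => (hR n).2.1, fun n => ?_, fun n => ?_, fun n => ?_,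
    fun n => ?_, fun n => ?_, fun n => (hR n).2.2.2.2.2.2.2⟩
  · rw [hpz]; exact (hR n).2.2.1
  · rw [hpz]; exact (hR n).2.2.2.1
  · rw [hpv]; exact (hR n).2.2.2.2.1
  · have := (hR (n + 1)).2.2.2.2.2.1
    rw [hpv]
    rwa [show (x (n + 1)).2.2 = (c n).1.1 by rw [hstep]] at this
  · rw [hpv]; exact (hR n).2.2.2.2.2.2.1

end Admissible

/-! ### The limit series and its modules of values -/

section Construction

variable {K : Type*} [Field K] {ι : FunField (Fin 2) K →ₐ[K] HahnSeries ℚ K}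
  {lam alpha tau : ℕ → ℚ} {f g : ℕ → MvPolynomial (Fin 2) K}

theorem IsConstruction.prod_ne_zero (h : IsConstruction ι lam alpha tau f g) (i : ℕ) :
    ∏ j ∈ Finset.range i, g j ≠ 0 :=
  Finset.prod_ne_zero_iff.2 fun j _ => h.g_ne_zero j

theorem IsConstruction.exists_prodVal (h : IsConstruction ι lam alpha tau f g)
    (hι : IsAdmissible ι) (i : ℕ) : ∃ c : ℚ, 0 ≤ c ∧ prodVal ι g i = (c : WithTop ℚ) := by
  obtain ⟨c, hc⟩ := exists_coe_val_ratFun (ι := ι) (h.prod_ne_zero i)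
  refine ⟨c, ?_, hc⟩
  have h1 : 0 ≤ tVal K (ι (ratFun (∏ j ∈ Finset.range i, g j))) := by
    rw [← aeval_xyPt]
    exact val_nonneg (trivialOn_tVal K) _
      (fun i => by rw [MvPolynomial.aeval_X]; exact hι.xyPt_pos i) _
  have h2 : tVal K (ι (ratFun (∏ j ∈ Finset.range i, g j))) = (c : WithTop ℚ) := hc
  rw [h2] at h1
  exact WithTop.coe_le_coe.1 h1

theorem IsConstruction.tau_lt_alpha (h : IsConstruction ι lam alpha tau f g)
    (hι : IsAdmissible ι) (i : ℕ) : tau i < alpha i := by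
  obtain ⟨c, -, hc⟩ := h.exists_prodVal hι i
  have h1 := h.lam_gt_tau i
  rw [← h.alpha_eq i, hc, ← WithTop.coe_add, ← WithTop.coe_add, WithTop.coe_lt_coe] at h1
  linarith

theorem IsConstruction.strictMono_alpha (h : IsConstruction ι lam alpha tau f g)
    (hι : IsAdmissible ι) : StrictMono alpha := by
  refine strictMono_nat_of_lt_succ fun i => ?_
  obtain ⟨c, hc0, hc⟩ := h.exists_prodVal hι i
  obtain ⟨d, -, hd⟩ := h.exists_prodVal hι (i + 1)
  have h1 := h.lam_gt_lam i
  rw [← h.alpha_eq i, ← h.alpha_eq (i + 1), hc, hd, ← WithTop.coe_add, ← WithTop.coe_add,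
    ← WithTop.coe_add, WithTop.coe_lt_coe] at h1
  linarith

/-- The `alpha i` are unbounded, because `tau i` is at least the value of `x ^ (i + 1)`. -/
theorem IsConstruction.exists_lt_alpha (h : IsConstruction ι lam alpha tau f g)
    (hι : IsAdmissible ι) (M : ℚ) : ∃ i, M < alpha i := by
  obtain ⟨s, hs⟩ := exists_coe_val_ratFun (ι := ι) (MvPolynomial.X_ne_zero (R := K) (0 : Fin 2))
  have hs' : tVal K (ι (ratFun (MvPolynomial.X 0))) = (s : WithTop ℚ) := hs
  have hs0 : 0 < s := by
    have hpos := hι.X_pos 0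
    rw [hs'] at hpos
    exact WithTop.coe_lt_coe.1 hpos
  obtain ⟨i, hi⟩ := exists_nat_gt (M / s)
  rw [div_lt_iff₀ hs0] at hi
  refine ⟨i, lt_of_lt_of_le ?_ (h.tau_lt_alpha hι i).le⟩
  have h1 : ((i + 1 : ℕ) : ℚ) * s ≤ tau i := (h.tau_max i).2 ⟨MvPolynomial.X 0 ^ (i + 1), by
    rw [MvPolynomial.totalDegree_X_pow], by
    rw [map_pow, evalZ, MvPolynomial.aeval_X]
    change tVal K (ι (ratFun (MvPolynomial.X 0)) ^ (i + 1)) = _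
    rw [AddValuation.map_pow, hs', ← WithTop.coe_nsmul, nsmul_eq_mul]⟩
  push_cast at h1
  linarith

theorem partialZ_succ_sub (i : ℕ) :
    partialZ ι f g (i + 1) - partialZ ι f g i = ι (ratFun (f i) / ratFun (g i)) := by
  rw [partialZ, partialZ, Finset.sum_range_succ, map_add, add_sub_cancel_left]

theorem IsConstruction.partialZ_pos (h : IsConstruction ι lam alpha tau f g) (i : ℕ) :
    0 < tVal K (partialZ ι f g i) := by
  induction i with
  | zero =>
    rw [partialZ, Finset.sum_range_zero, map_zero, AddValuation.map_zero]
    exact WithTop.coe_lt_top 0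
  | succ i ih =>
    rw [← sub_add_cancel (partialZ ι f g (i + 1)) (partialZ ι f g i), partialZ_succ_sub]
    refine AddValuation.map_lt_add _ ?_ ih
    have h1 : tVal K (ι (ratFun (f i) / ratFun (g i))) = (alpha i : WithTop ℚ) := h.val_eq i
    rw [h1]
    exact WithTop.coe_lt_coe.2 (h.pos i).2.1

theorem IsConstruction.exists_limit (h : IsConstruction ι lam alpha tau f g)
    (hι : IsAdmissible ι) :
    ∃ z, ∀ i, tVal K (z - partialZ ι f g i) = (alpha i : WithTop ℚ) :=
  ValSemigroup.exists_limit (h.strictMono_alpha hι) (h.exists_lt_alpha hι) fun i => by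
    rw [partialZ_succ_sub]
    exact h.val_eq i

variable {z : HahnSeries ℚ K}

theorem IsConstruction.isLimit (h : IsConstruction ι lam alpha tau f g) (hι : IsAdmissible ι)
    (hz : ∀ i, tVal K (z - partialZ ι f g i) = (alpha i : WithTop ℚ)) :
    IsLimit (partialZ ι f g) z := fun M => by
  obtain ⟨N, hN⟩ := h.exists_lt_alpha hι M
  refine ⟨N, fun i hi => ?_⟩
  rw [hz]
  exact WithTop.coe_lt_coe.2 (hN.trans_le ((h.strictMono_alpha hι).monotone hi))

theorem IsConstruction.limit_pos (h : IsConstruction ι lam alpha tau f g)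
    (hz : ∀ i, tVal K (z - partialZ ι f g i) = (alpha i : WithTop ℚ)) : 0 < tVal K z := by
  have h0 := hz 0
  rw [partialZ, Finset.sum_range_zero, map_zero, sub_zero] at h0
  rw [h0]
  exact WithTop.coe_lt_coe.2 (h.pos 0).2.1

/-- A nonzero polynomial has the same finite value at the limit and at the far partial sums. -/
theorem IsConstruction.eventually_val_evalZ_eq (h : IsConstruction ι lam alpha tau f g)
    (hι : IsAdmissible ι) (hz : ∀ i, tVal K (z - partialZ ι f g i) = (alpha i : WithTop ℚ))
    {p : MvPolynomial (Fin 3) K} (hp : p ≠ 0) :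
    ∃ N, ∀ i ≥ N, evalZ ι (partialZ ι f g i) p ≠ 0 ∧
      tVal K (evalZ ι z p) = tVal K (evalZ ι (partialZ ι f g i) p) := by
  simp only [evalZ_eq]
  refine eventually_val_aeval_eq (trivialOn_tVal K) aeval_xyPt_injective
    (fun i => (hι.xyPt_pos i).le) (fun i => (h.partialZ_pos i).le) (h.limit_pos hz).le ?_ ?_ hp
  · intro i j hij
    have h1 := hz i
    rw [hij, hz j, WithTop.coe_inj] at h1
    exact ((h.strictMono_alpha hι).injective h1).symm
  · intro i q hq hq0
    obtain ⟨s, hs⟩ := WithTop.ne_top_iff_exists.1 ((AddValuation.ne_top_iff (tVal K)).2 hq0)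
    rw [hz, ← hs, WithTop.coe_lt_coe]
    refine lt_of_le_of_lt ((h.tau_max i).2 ⟨q, hq, ?_⟩) (h.tau_lt_alpha hι i)
    rw [evalZ_eq, hs]

theorem IsConstruction.evalZ_injective (h : IsConstruction ι lam alpha tau f g)
    (hι : IsAdmissible ι) (hz : ∀ i, tVal K (z - partialZ ι f g i) = (alpha i : WithTop ℚ)) :
    Function.Injective (evalZ ι z) := by
  rw [injective_iff_map_eq_zero]
  intro p hp
  by_contra hne
  obtain ⟨N, hN⟩ := h.eventually_val_evalZ_eq hι hz hne
  obtain ⟨h1, h2⟩ := hN N le_rfl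
  rw [hp, AddValuation.map_zero] at h2
  exact h1 ((AddValuation.top_iff _).1 h2.symm)

/-- The value `lam i` is that of `g₀ ⋯ g_{i-1} (z - z_i)`, which is a polynomial of degree `1` in
`z`. -/
theorem IsConstruction.lam_mem_polyValues (h : IsConstruction ι lam alpha tau f g)
    (hz : ∀ i, tVal K (z - partialZ ι f g i) = (alpha i : WithTop ℚ)) (i : ℕ) :
    lam i ∈ polyValues ι z 1 := by
  obtain ⟨r, hr⟩ : ∃ r : MvPolynomial (Fin 2) K, ratFun r =
      ratFun (∏ j ∈ Finset.range i, g j) * ∑ j ∈ Finset.range i, ratFun (f j) / ratFun (g j) := by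
    refine ⟨∑ j ∈ Finset.range i, (∏ k ∈ (Finset.range i).erase j, g k) * f j, ?_⟩
    have hmul : ∀ a b : MvPolynomial (Fin 2) K, ratFun (a * b) = ratFun a * ratFun b :=
      map_mul (algebraMap _ _)
    rw [Finset.mul_sum]
    refine (map_sum (algebraMap (MvPolynomial (Fin 2) K) (FunField (Fin 2) K)) _ _).trans
      (Finset.sum_congr rfl fun j hj => ?_)
    change ratFun _ = _
    rw [← Finset.prod_erase_mul _ _ hj, hmul, hmul]
    have := ratFun_ne_zero.2 (h.g_ne_zero j)
    field_simp
  refine ⟨MvPolynomial.rename Fin.castSucc (∏ j ∈ Finset.range i, g j) * MvPolynomial.X 2 -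
    MvPolynomial.rename Fin.castSucc r, ?_, ?_⟩
  · refine (MvPolynomial.degreeOf_sub_le _ _ _).trans ?_
    rw [degreeOf_rename_castSucc]
    refine max_le ((MvPolynomial.degreeOf_mul_le _ _ _).trans ?_) zero_le_one
    rw [degreeOf_rename_castSucc, MvPolynomial.degreeOf_X]
    simp
  · rw [map_sub, map_mul, evalZ_rename, evalZ_rename, hr, map_mul, ← partialZ]
    have hX : evalZ ι z (MvPolynomial.X 2) = z := by rw [evalZ, MvPolynomial.aeval_X]; rfl
    rw [hX, ← mul_sub, AddValuation.map_mul, hz, add_comm]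
    exact h.alpha_eq i

theorem polyValues_mono (w : HahnSeries ℚ K) {m n : ℕ} (hmn : m ≤ n) :
    polyValues ι w m ⊆ polyValues ι w n := fun _ ⟨p, hp, hq⟩ => ⟨p, hp.trans hmn, hq⟩

/-- The obstruction to finite generation: finitely many values of polynomials at `z` are values at
some `z_i`, but `lam i` is not. -/
theorem IsConstruction.not_isFGOver (h : IsConstruction ι lam alpha tau f g)
    (hι : IsAdmissible ι) (hz : ∀ i, tVal K (z - partialZ ι f g i) = (alpha i : WithTop ℚ))
    {M : Set ℚ} (hM : ∀ i, lam i ∈ M)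
    (hM' : ∀ q ∈ M, ∃ p, tVal K (evalZ ι z p) = (q : WithTop ℚ)) :
    ¬ IsFGOver (F0 ι) M := by
  rintro ⟨m, hm, hMm⟩
  have hN : ∀ q ∈ M, ∃ N, ∀ i ≥ N, q ∈ locValues ι (partialZ ι f g i) := by
    intro q hq
    obtain ⟨p, hp⟩ := hM' q hq
    have hp0 : p ≠ 0 := by
      rintro rfl
      rw [map_zero, AddValuation.map_zero] at hp
      exact WithTop.top_ne_coe hp
    obtain ⟨N, hN⟩ := h.eventually_val_evalZ_eq hι hz hp0
    refine ⟨N, fun i hi => (hι.mem_locValues_iff (h.partialZ_pos i) q).2 ⟨p, ?_⟩⟩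
    rw [← (hN i hi).2, hp]
  choose! N hN using hN
  have hi := hM (m.sup N)
  rw [hMm] at hi
  obtain ⟨s, hs, a, ha, heq⟩ := hi
  refine h.lam_notMem (m.sup N) ?_
  rw [heq]
  exact hι.add_mem_locValues (h.partialZ_pos _) hs (hN a (hm ha) _ (Finset.le_sup ha))

/-- Clearing denominators, an algebraic relation over `K(x, y)` becomes one over `K[x, y]`. -/
theorem transcendental_of_evalZ_injective (hinj : Function.Injective (evalZ ι z)) :
    Transcendental ι.range z := by
  rintro ⟨P, hP, hPz⟩
  let ε : FunField (Fin 2) K ≃ₐ[K] ι.range :=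
    AlgEquiv.ofInjective ι ι.toRingHom.injective
  set P₀ : Polynomial (FunField (Fin 2) K) := P.map ε.symm.toRingEquiv.toRingHom with hP₀
  have hP₀0 : P₀ ≠ 0 :=
    (Polynomial.map_ne_zero_iff (f := ε.symm.toRingEquiv.toRingHom) ε.symm.injective).2 hP
  have hev : P₀.eval₂ (ι : FunField (Fin 2) K →+* HahnSeries ℚ K) z = 0 := by
    rw [hP₀, Polynomial.eval₂_map]
    have : (ι : FunField (Fin 2) K →+* HahnSeries ℚ K).comp ε.symm.toRingEquiv.toRingHom =
        algebraMap ι.range (HahnSeries ℚ K) :=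
      RingHom.ext fun x => congrArg Subtype.val (ε.apply_symm_apply x)
    rw [this]
    exact hPz
  have h1 := IsLocalization.integerNormalization_eval₂_eq_zero
    (M := nonZeroDivisors (MvPolynomial (Fin 2) K))
    (ι : FunField (Fin 2) K →+* HahnSeries ℚ K) P₀ hev
  set Q := IsLocalization.integerNormalization (nonZeroDivisors (MvPolynomial (Fin 2) K)) P₀
  have hQ : Q ≠ 0 := (IsFractionRing.integerNormalization_eq_zero_iff).not.2 hP₀0
  have h2 : (MvPolynomial.aeval (R := K) (xyPt ι)).toRingHom =
      (ι : FunField (Fin 2) K →+* HahnSeries ℚ K).comp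
        (algebraMap (MvPolynomial (Fin 2) K) (FunField (Fin 2) K)) :=
    RingHom.ext fun p => aeval_xyPt p
  rw [← h2, ← (lastVarEquiv K 2).apply_symm_apply Q, eval₂_lastVarEquiv, ← evalZ_eq] at h1
  have h3 := (map_eq_zero_iff _ hinj).1 h1
  exact hQ ((map_eq_zero_iff _ (lastVarEquiv K 2).symm.injective).1 h3)

/-- The inclusion of `K[x, y, z]_{(x, y, z)}` for `z` transcendental over `K(x, y)`. -/
def locHom (hinj : Function.Injective (evalZ ι z)) : LocRing (Fin 3) K →ₐ[K] HahnSeries ℚ K :=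
  (liftFun (evalZ ι z) hinj).comp
    (IsScalarTower.toAlgHom K (LocRing (Fin 3) K) (FunField (Fin 3) K))

theorem locHom_injective (hinj : Function.Injective (evalZ ι z)) :
    Function.Injective (locHom hinj) :=
  (liftFun (evalZ ι z) hinj).toRingHom.injective.comp
    (IsFractionRing.injective (LocRing (Fin 3) K) (FunField (Fin 3) K))

theorem locHom_algebraMap (hinj : Function.Injective (evalZ ι z)) (p : MvPolynomial (Fin 3) K) :
    locHom hinj (algebraMap _ _ p) = evalZ ι z p := liftFun_ratFun _ hinj p

theorem range_locHom (hinj : Function.Injective (evalZ ι z)) :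
    (locHom hinj : LocRing (Fin 3) K →+* HahnSeries ℚ K).range = locAt ι z := by
  ext b
  constructor
  · rintro ⟨a, rfl⟩
    obtain ⟨p, s, hs, h⟩ := exists_mul_eq_algebraMap a
    refine ⟨p, s, hs, ?_⟩
    have hs0 : evalZ ι z s ≠ 0 := by
      rw [← locHom_algebraMap hinj]
      exact ((isUnit_algebraMap_locRing.2 hs).map (locHom hinj)).ne_zero
    rw [eq_div_iff hs0, ← locHom_algebraMap hinj, ← locHom_algebraMap hinj, ← h, map_mul]
    rfl
  · rintro ⟨p, s, hs, rfl⟩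
    have hu := isUnit_algebraMap_locRing.2 hs
    refine ⟨algebraMap _ _ p * ↑(hu.unit⁻¹), ?_⟩
    have hs0 : evalZ ι z s ≠ 0 := by
      rw [← locHom_algebraMap hinj]
      exact (hu.map (locHom hinj)).ne_zero
    rw [eq_div_iff hs0]
    change locHom hinj _ * _ = _
    rw [← locHom_algebraMap hinj, ← locHom_algebraMap hinj, ← map_mul, mul_assoc,
      hu.val_inv_mul, mul_one]

/-- `K[x, y, z]_{(x, y, z)}` is isomorphic to the local ring of affine space, for `z`
transcendental over `K(x, y)`. -/
def locAtEquiv (hinj : Function.Injective (evalZ ι z)) : LocRing (Fin 3) K ≃+* locAt ι z :=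
  (RingEquiv.ofLeftInverse (f := (locHom hinj : LocRing (Fin 3) K →+* HahnSeries ℚ K))
    (Function.leftInverse_invFun (locHom_injective hinj))).trans
    (RingEquiv.subringCongr (range_locHom hinj))

theorem ringKrullDim_locAt (hinj : Function.Injective (evalZ ι z)) :
    ringKrullDim (locAt ι z) = 3 := by
  rw [← ringKrullDim_eq_of_ringEquiv (locAtEquiv hinj), ringKrullDim_locRing]
  rfl

theorem IsAdmissible.dominates_locAt (hι : IsAdmissible ι)
    (hinj : Function.Injective (evalZ ι z)) (hz : 0 < tVal K z) :
    Dominates (tVal K) (locAt ι z).subtype := by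
  have h := dominates_locRing (trivialOn_tVal K) (locHom hinj) (locHom_injective hinj)
    (fun i => by rw [locHom_algebraMap]; exact hι.evalZ_X_pos hz i)
  refine ⟨Subtype.val_injective, (locAtEquiv hinj).isLocalRing, fun b => ?_⟩
  obtain ⟨a, rfl⟩ := (locAtEquiv hinj).surjective b
  refine ⟨(h.2.2 a).1, ?_⟩
  rw [mem_nonunits_iff, MulEquiv.isUnit_map (locAtEquiv hinj)]
  exact (h.2.2 a).2

end Construction

/-! ### Pairs as values -/

section LexPair

/-- The pair `(n, q)`, as a value. -/
abbrev lexPair (n : ℤ) (q : ℚ) : WithTop (ℤ ×ₗ ℚ) := ((toLex (n, q) : ℤ ×ₗ ℚ) : WithTop (ℤ ×ₗ ℚ))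

theorem lexPair_le_lexPair {m n : ℤ} {q r : ℚ} :
    lexPair m q ≤ lexPair n r ↔ m < n ∨ m = n ∧ q ≤ r := by
  rw [WithTop.coe_le_coe, Prod.Lex.toLex_le_toLex]

theorem lexPair_lt_lexPair {m n : ℤ} {q r : ℚ} :
    lexPair m q < lexPair n r ↔ m < n ∨ m = n ∧ q < r := by
  rw [WithTop.coe_lt_coe, Prod.Lex.toLex_lt_toLex]

theorem lexPair_inj {m n : ℤ} {q r : ℚ} : lexPair m q = lexPair n r ↔ m = n ∧ q = r := by
  rw [WithTop.coe_inj, toLex_inj, Prod.mk.injEq]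

theorem lexPair_add (m n : ℤ) (q r : ℚ) :
    lexPair m q + lexPair n r = lexPair (m + n) (q + r) := rfl

theorem lexPair_zero : lexPair 0 0 = 0 := rfl

theorem nsmul_lexPair (k : ℕ) (n : ℤ) (q : ℚ) : k • lexPair n q = lexPair (k * n) (k * q) := by
  induction k with
  | zero => simp
  | succ k ih =>
    rw [succ_nsmul, ih, lexPair_add]
    push_cast
    rw [add_mul, one_mul, add_mul, one_mul]

theorem eq_top_or_lexPair (γ : WithTop (ℤ ×ₗ ℚ)) : γ = ⊤ ∨ ∃ n q, γ = lexPair n q := by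
  cases γ with
  | top => exact Or.inl rfl
  | coe γ => exact Or.inr ⟨(ofLex γ).1, (ofLex γ).2, rfl⟩

end LexPair

/-! ### The rank of a valuation with value group `ℤ × ℚ` -/

section Rank

variable {L : Type*} [Field L] {Γ : Type*} [AddCommGroup Γ] [LinearOrder Γ] [IsOrderedAddMonoid Γ]

theorem dvd_of_val_le {v : AddValuation L (WithTop Γ)} {a b : valRing v}
    (h : v (a : L) ≤ v (b : L)) : a ∣ b := by
  by_cases ha : (a : L) = 0
  · rw [ha, AddValuation.map_zero, top_le_iff, AddValuation.top_iff] at h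
    have hb : b = 0 := Subtype.ext h
    rw [hb]
    exact dvd_zero a
  · have hc : 0 ≤ v ((b : L) / a) := by
      have h1 : v ((b : L) / a) + v (a : L) = v (b : L) := by
        rw [← v.map_mul, div_mul_cancel₀ _ ha]
      by_contra hneg
      rw [not_le] at hneg
      have h2 : v ((b : L) / a) + v (a : L) < 0 + v (a : L) :=
        WithTop.add_lt_add_right ((AddValuation.ne_top_iff v).2 ha) hneg
      rw [h1, zero_add] at h2
      exact absurd h (not_le.2 h2)
    exact ⟨⟨(b : L) / a, hc⟩, Subtype.ext (mul_div_cancel₀ _ ha).symm⟩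

theorem isUnit_valRing_iff {v : AddValuation L (WithTop Γ)} {a : valRing v} :
    IsUnit a ↔ v (a : L) = 0 := by
  rw [isUnit_iff_dvd_one]
  constructor
  · rintro ⟨b, hb⟩
    have h1 : v (a : L) + v (b : L) = 0 := by
      rw [← v.map_mul, ← v.map_one]
      exact congrArg (fun c : valRing v => v (c : L)) hb.symm
    refine le_antisymm ?_ a.2
    rw [← h1]
    exact le_add_of_nonneg_right b.2
  · intro h
    refine dvd_of_val_le ?_
    rw [h, OneMemClass.coe_one, v.map_one]

variable (ν : AddValuation L (WithTop (ℤ ×ₗ ℚ)))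

/-- The prime ideal of the elements of a valuation ring whose value has a positive first
component. -/
def infPrime : Ideal (valRing ν) where
  carrier := {a | ∀ q : ℚ, lexPair 0 q ≤ ν (a : L)}
  zero_mem' := fun q => by simp
  add_mem' := fun ha hb q => ν.map_le_add (ha q) (hb q)
  smul_mem' := fun c a ha q => by
    change _ ≤ ν ((c : L) * a)
    rw [ν.map_mul]
    exact (ha q).trans (le_add_of_nonneg_left c.2)

variable {ν}

theorem mem_infPrime {a : valRing ν} : a ∈ infPrime ν ↔ ∀ q : ℚ, lexPair 0 q ≤ ν (a : L) := Iff.rfl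

theorem exists_eq_of_notMem_infPrime {a : valRing ν} (ha : a ∉ infPrime ν) :
    ∃ r, 0 ≤ r ∧ ν (a : L) = lexPair 0 r := by
  rw [mem_infPrime, not_forall] at ha
  obtain ⟨q, hq⟩ := ha
  rw [not_le] at hq
  have h0 : lexPair 0 0 ≤ ν (a : L) := a.2
  rcases eq_top_or_lexPair (ν (a : L)) with h | ⟨n, r, h⟩
  · rw [h] at hq
    exact absurd hq (not_lt.2 le_top)
  · rw [h, lexPair_lt_lexPair] at hq
    rw [h, lexPair_le_lexPair] at h0
    obtain rfl : n = 0 := by omega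
    exact ⟨r, by simpa using h0, h⟩

theorem exists_le_of_mem_infPrime {a : valRing ν} (ha : a ∈ infPrime ν) (ha0 : a ≠ 0) :
    ∃ n r, 1 ≤ n ∧ ν (a : L) = lexPair n r := by
  rcases eq_top_or_lexPair (ν (a : L)) with h | ⟨n, r, h⟩
  · exact absurd (Subtype.ext ((AddValuation.top_iff ν).1 h)) ha0
  · have h1 := mem_infPrime.1 ha (r + 1)
    rw [h, lexPair_le_lexPair] at h1
    refine ⟨n, r, ?_, h⟩
    rcases h1 with h1 | ⟨-, h1⟩
    · omega
    · linarith

instance isPrime_infPrime : (infPrime ν).IsPrime := by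
  refine ⟨fun h => ?_, fun {a b} hab => ?_⟩
  · have h1 := mem_infPrime.1 ((Ideal.eq_top_iff_one _).1 h) 1
    rw [OneMemClass.coe_one, ν.map_one, ← lexPair_zero, lexPair_le_lexPair] at h1
    norm_num at h1
  · by_contra! hcon
    obtain ⟨r, -, hr⟩ := exists_eq_of_notMem_infPrime hcon.1
    obtain ⟨s, -, hs⟩ := exists_eq_of_notMem_infPrime hcon.2
    have h1 := mem_infPrime.1 hab (r + s + 1)
    have h2 : ν ((a * b : valRing ν) : L) = lexPair 0 (r + s) := by
      change ν ((a : L) * b) = _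
      rw [ν.map_mul, hr, hs, lexPair_add, add_zero]
    rw [h2, lexPair_le_lexPair] at h1
    simp at h1
    linarith

/-- A prime ideal of the valuation ring which is not contained in `infPrime` is maximal. -/
theorem eq_maximalIdeal_of_not_le {p : Ideal (valRing ν)} [hp : p.IsPrime]
    (h : ¬ p ≤ infPrime ν) : p = IsLocalRing.maximalIdeal (valRing ν) := by
  obtain ⟨f, hfp, hf⟩ := Set.not_subset.1 h
  obtain ⟨q, hq0, hq⟩ := exists_eq_of_notMem_infPrime hf
  refine le_antisymm (IsLocalRing.le_maximalIdeal hp.ne_top) fun g hg => ?_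
  rw [IsLocalRing.mem_maximalIdeal, mem_nonunits_iff, isUnit_valRing_iff] at hg
  have hg0 : 0 < ν (g : L) := lt_of_le_of_ne g.2 (Ne.symm hg)
  obtain ⟨r, hr0, hr⟩ : ∃ r : ℚ, 0 < r ∧ lexPair 0 r ≤ ν (g : L) := by
    by_cases hgI : g ∈ infPrime ν
    · exact ⟨1, one_pos, hgI 1⟩
    · obtain ⟨r, -, hr⟩ := exists_eq_of_notMem_infPrime hgI
      rw [hr, ← lexPair_zero, lexPair_lt_lexPair] at hg0
      exact ⟨r, by simpa using hg0, hr.ge⟩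
  obtain ⟨k, hk⟩ := exists_nat_gt (q / r)
  rw [div_lt_iff₀ hr0] at hk
  have hdvd : f ∣ g ^ k := by
    refine dvd_of_val_le ?_
    change ν (f : L) ≤ ν ((g : L) ^ k)
    rw [hq, ν.map_pow]
    refine le_trans ?_ (nsmul_le_nsmul_right hr k)
    rw [nsmul_lexPair, mul_zero, lexPair_le_lexPair]
    exact Or.inr ⟨rfl, hk.le⟩
  exact hp.mem_of_pow_mem k (p.mem_of_dvd hdvd hfp)

theorem eq_infPrime_of_le {p : Ideal (valRing ν)} [hp : p.IsPrime] (h : p ≤ infPrime ν)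
    (hp0 : p ≠ ⊥) : p = infPrime ν := by
  refine le_antisymm h fun g hg => ?_
  by_cases hg0 : g = 0
  · rw [hg0]; exact p.zero_mem
  obtain ⟨f, hfp, hf0⟩ := Submodule.exists_mem_ne_zero_of_ne_bot hp0
  obtain ⟨n, r, hn, hf⟩ := exists_le_of_mem_infPrime (h hfp) hf0
  obtain ⟨m, s, hm, hgv⟩ := exists_le_of_mem_infPrime hg hg0
  have hdvd : f ∣ g ^ (n.toNat + 1) := by
    refine dvd_of_val_le ?_
    change ν (f : L) ≤ ν ((g : L) ^ (n.toNat + 1))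
    rw [hf, ν.map_pow, hgv, nsmul_lexPair, lexPair_le_lexPair]
    left
    push_cast
    rw [Int.toNat_of_nonneg (by omega)]
    nlinarith
  exact hp.mem_of_pow_mem _ (p.mem_of_dvd hdvd hfp)

/-- A valuation with value group `ℤ × ℚ` has rank `2`: the prime ideals of its ring are `0`,
`infPrime` and the maximal ideal. -/
theorem valRank_eq_two (hν : HasValueGroup ν) : valRank ν = 2 := by
  classical
  let M : PrimeSpectrum (valRing ν) := ⟨IsLocalRing.maximalIdeal (valRing ν), inferInstance⟩
  let P : PrimeSpectrum (valRing ν) := ⟨infPrime ν, inferInstance⟩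
  let Z : PrimeSpectrum (valRing ν) := ⟨⊥, inferInstance⟩
  have hZP : Z < P := by
    refine lt_of_le_of_ne (bot_le (a := infPrime ν)) fun h => ?_
    obtain ⟨f, hf⟩ := hν (toLex (1, 0))
    have h0 : 0 ≤ ν f := by
      rw [hf]; exact lexPair_le_lexPair.2 (Or.inl one_pos)
    have hmem : (⟨f, h0⟩ : valRing ν) ∈ infPrime ν := fun q => by
      change _ ≤ ν f
      rw [hf]; exact lexPair_le_lexPair.2 (Or.inl one_pos)
    have heq : (⊥ : Ideal (valRing ν)) = infPrime ν := congrArg PrimeSpectrum.asIdeal h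
    rw [← heq, Ideal.mem_bot] at hmem
    have : f = 0 := congrArg Subtype.val hmem
    rw [this, ν.map_zero] at hf
    exact WithTop.top_ne_coe hf
  have hPM : P < M := by
    refine lt_of_le_of_ne (IsLocalRing.le_maximalIdeal Ideal.IsPrime.ne_top') fun h => ?_
    obtain ⟨f, hf⟩ := hν (toLex (0, 1))
    have h0 : 0 ≤ ν f := by
      rw [hf]; exact lexPair_le_lexPair.2 (Or.inr ⟨rfl, zero_le_one⟩)
    have hmem : (⟨f, h0⟩ : valRing ν) ∈ IsLocalRing.maximalIdeal (valRing ν) := by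
      rw [IsLocalRing.mem_maximalIdeal, mem_nonunits_iff, isUnit_valRing_iff]
      change ν f ≠ 0
      rw [hf, ← lexPair_zero]
      exact fun h => zero_ne_one (lexPair_inj.1 h).2.symm
    have heq : infPrime ν = IsLocalRing.maximalIdeal (valRing ν) := congrArg PrimeSpectrum.asIdeal h
    rw [← heq] at hmem
    have h2 := mem_infPrime.1 hmem 2
    change _ ≤ ν f at h2
    rw [hf, lexPair_le_lexPair] at h2
    norm_num at h2
  refine le_antisymm ?_ ?_
  · have hle : valRank ν ≤ Order.krullDim (Fin 3) := by
      refine Order.krullDim_le_of_strictMono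
        (fun p => if p = Z then 0 else if p = P then 1 else 2) fun p q hpq => ?_
      have hqZ : q ≠ Z := fun h => by
        have : p.asIdeal < ⊥ := by rw [h] at hpq; exact hpq
        exact not_lt_bot this
      have hcls : ∀ r : PrimeSpectrum (valRing ν), r ≠ Z → r ≠ P → r = M := by
        intro r hrZ hrP
        have := r.isPrime
        by_cases hr : r.asIdeal ≤ infPrime ν
        · exact absurd (PrimeSpectrum.ext (eq_infPrime_of_le hr
            fun h => hrZ (PrimeSpectrum.ext h))) hrP
        · exact PrimeSpectrum.ext (eq_maximalIdeal_of_not_le hr)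
      by_cases hpZ : p = Z
      · by_cases hqP : q = P <;> simp [hpZ, hqP, hqZ, hZP.ne']
      · by_cases hpP : p = P
        · have hqP : q ≠ P := fun h => hpq.ne (hpP.trans h.symm)
          simp [hpP, hqP, hqZ, hZP.ne']
        · have hpM := hcls p hpZ hpP
          rw [hpM] at hpq
          exact absurd (IsLocalRing.le_maximalIdeal q.isPrime.ne_top) (not_le_of_gt hpq)
    refine hle.trans (iSup_le fun p => ?_)
    have h3 := Fintype.card_le_of_injective p p.strictMono.injective
    rw [Fintype.card_fin, Fintype.card_fin] at h3
    exact_mod_cast (by omega : p.length ≤ 2)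
  · exact Order.le_krullDim_iff.2 ⟨⟨2, ![Z, P, M], fun i => by
      fin_cases i
      · exact hZP
      · exact hPM⟩, rfl⟩

end Rank

/-! ### Finite generation of the graded modules -/

section GradedFiniteness

variable {R : Type*} [CommRing R] (v : AddValuation R (WithTop (ℤ ×ₗ ℚ)))

/-- The set of those `δ` for which `(n, δ)` is a value. -/
def sliceValues (n : ℤ) : Set ℚ := {δ | ∃ a : R, v a = lexPair n δ}

theorem GrPart.mk_eq_zero (n : ℤ) (δ : ℚ) (a : valIdeal v (toLex (n, δ))) :
    GrPart.mk v n δ a = 0 ↔ lexPair n δ < v (a : R) := GrComp.mk_eq_zero v _ a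

theorem GrPart.eq_zero_of_notMem {n : ℤ} {δ : ℚ} (hδ : δ ∉ sliceValues v n) (a : GrPart v n δ) :
    a = 0 := by
  induction a using GrPart.ind with
  | h f =>
    rw [GrPart.mk_eq_zero]
    exact lt_of_le_of_ne f.2 fun h => hδ ⟨f, h.symm⟩

theorem GrPart.exists_ne_zero {n : ℤ} {δ : ℚ} (hδ : δ ∈ sliceValues v n) :
    ∃ a : GrPart v n δ, a ≠ 0 := by
  obtain ⟨f, hf⟩ := hδ
  refine ⟨GrPart.mk v n δ ⟨f, hf.ge⟩, ?_⟩
  rw [Ne, GrPart.mk_eq_zero, not_lt]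
  exact hf.le

/-- The elements of the graded module supported in degrees which belong to `W`, if `W` is stable
under addition of the degrees of the graded ring. -/
def supportedIn (n : ℤ) (W : Set ℚ) (hW : ∀ a ∈ sliceValues v 0, ∀ b ∈ W, a + b ∈ W) :
    Submodule (GrResidual v) (GrSlice v n) where
  carrier := {m | ∀ δ ∉ W, m δ = 0}
  zero_mem' := fun δ _ => rfl
  add_mem' := fun {a b} ha hb δ hδ => by
    rw [DirectSum.add_apply, ha δ hδ, hb δ hδ, add_zero]
  smul_mem' := fun r m hm => by
    classical
    induction r using DirectSum.induction_on with
    | zero => intro δ _; rw [zero_smul]; rfl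
    | add r s hr hs =>
      intro δ hδ
      rw [add_smul, DirectSum.add_apply, hr δ hδ, hs δ hδ, add_zero]
    | of ε a =>
      intro δ hδ
      rw [← DirectSum.sum_support_of m, Finset.smul_sum, DFinsupp.finsetSum_apply]
      refine Finset.sum_eq_zero fun η _ => ?_
      rw [DirectSum.Gmodule.of_smul_of]
      by_cases h : ε + η = δ
      · have h0 : GradedMonoid.GSMul.smul a (m η) = (0 : GrPart v n (ε + η)) := by
          by_cases hη : η ∈ W
          · have hε : ε ∉ sliceValues v 0 := fun hε => hδ (h ▸ hW ε hε η hη)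
            rw [GrPart.eq_zero_of_notMem v hε a]
            exact DirectSum.Gmodule.zero_smul _
          · rw [hm η hη]
            exact DirectSum.GdistribMulAction.smul_zero _
        exact (congrArg (fun x => DirectSum.of (GrPart v n) (ε + η) x δ) h0).trans
          (by rw [map_zero]; rfl)
      · exact DirectSum.of_eq_of_ne _ _ _ (Ne.symm h)

/-- If the graded module of the values with first component `n` is finitely generated over the
graded ring, then the set of these values is finitely generated over the semigroup of values. -/
theorem isFGOver_of_finite (n : ℤ) (h : Module.Finite (GrResidual v) (GrSlice v n)) :
    IsFGOver (sliceValues v 0) (sliceValues v n) := by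
  classical
  obtain ⟨G, hG⟩ := h.fg_top
  set T : Finset ℚ := (G.biUnion fun m => DFinsupp.support m) with hT
  have hTm : ∀ m ∈ G, ∀ δ ∉ T, m δ = 0 := by
    intro m hm δ hδ
    by_contra hne
    exact hδ (Finset.mem_biUnion.2 ⟨m, hm, DFinsupp.mem_support_iff.2 hne⟩)
  have hTsub : ∀ δ ∈ T, δ ∈ sliceValues v n := by
    intro δ hδ
    obtain ⟨m, -, hm⟩ := Finset.mem_biUnion.1 hδ
    by_contra hnot
    exact DFinsupp.mem_support_iff.1 hm (GrPart.eq_zero_of_notMem v hnot _)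
  have hadd : ∀ {k : ℤ} {a b : ℚ}, a ∈ sliceValues v 0 → b ∈ sliceValues v k →
      a + b ∈ sliceValues v k := by
    rintro k a b ⟨f, hf⟩ ⟨g, hg⟩
    exact ⟨f * g, by rw [v.map_mul, hf, hg, lexPair_add, zero_add]⟩
  set W : Set ℚ := {q | ∃ s ∈ sliceValues v 0, ∃ a ∈ T, q = s + a} with hWdef
  have hW : ∀ a ∈ sliceValues v 0, ∀ b ∈ W, a + b ∈ W := by
    rintro a ha _ ⟨s, hs, b, hb, rfl⟩
    exact ⟨a + s, hadd ha hs, b, hb, (add_assoc a s b).symm⟩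
  have hTW : ∀ δ ∈ T, δ ∈ W := fun δ hδ =>
    ⟨0, ⟨1, v.map_one⟩, δ, hδ, (zero_add δ).symm⟩
  have htop : supportedIn v n W hW = ⊤ := by
    rw [eq_top_iff, ← hG, Submodule.span_le]
    exact fun m hm δ hδ => hTm m hm δ fun h => hδ (hTW δ h)
  refine ⟨T, hTsub, Set.Subset.antisymm (fun δ hδ => ?_) ?_⟩
  · by_contra hnot
    obtain ⟨a, ha⟩ := GrPart.exists_ne_zero v hδ
    have hmem : DirectSum.of (GrPart v n) δ a ∈ supportedIn v n W hW := by
      rw [htop]; exact Submodule.mem_top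
    have := hmem δ hnot
    rw [DirectSum.of_eq_same] at this
    exact ha this
  · rintro _ ⟨s, hs, a, ha, rfl⟩
    exact hadd hs (hTsub a ha)

end GradedFiniteness

/-! ### The composite valuation of `K((t^ℚ))((u))` -/

section LexVal

variable {K : Type*} [Field K]

/-- The field `K((t^ℚ))((u))`. -/
abbrev USeries (K : Type*) [Field K] : Type _ := HahnSeries ℤ (HahnSeries ℚ K)

/-- The order of a series in `u`, together with the order in `t` of its leading coefficient. -/
def lexOrder (x : USeries K) : WithTop (ℤ ×ₗ ℚ) :=
  open Classical in if x = 0 then ⊤ else lexPair x.order x.leadingCoeff.order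

theorem lexOrder_zero : lexOrder (0 : USeries K) = ⊤ := if_pos rfl

theorem lexOrder_of_ne {x : USeries K} (hx : x ≠ 0) :
    lexOrder x = lexPair x.order x.leadingCoeff.order := if_neg hx

/-- A description of the order by coefficients, from which the valuation axioms follow. -/
theorem lexPair_le_lexOrder {x : USeries K} {n : ℤ} {δ : ℚ} :
    lexPair n δ ≤ lexOrder x ↔
      (∀ m < n, x.coeff m = 0) ∧ (δ : WithTop ℚ) ≤ tVal K (x.coeff n) := by
  by_cases hx : x = 0
  · subst hx
    rw [lexOrder_zero]
    simp
  have hlc : x.coeff x.order ≠ 0 := fun h => hx (HahnSeries.coeff_order_eq_zero.1 h)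
  rw [lexOrder_of_ne hx, lexPair_le_lexPair, HahnSeries.leadingCoeff_eq]
  constructor
  · rintro (h | ⟨rfl, h⟩)
    · refine ⟨fun m hm => HahnSeries.coeff_eq_zero_of_lt_order (hm.trans h), ?_⟩
      rw [HahnSeries.coeff_eq_zero_of_lt_order h, AddValuation.map_zero]
      exact le_top
    · refine ⟨fun m hm => HahnSeries.coeff_eq_zero_of_lt_order hm, ?_⟩
      rw [HahnSeries.addVal_apply_of_ne hlc]
      exact WithTop.coe_le_coe.2 h
  · rintro ⟨h1, h2⟩
    rcases lt_trichotomy n x.order with h | rfl | h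
    · exact Or.inl h
    · rw [HahnSeries.addVal_apply_of_ne hlc, WithTop.coe_le_coe] at h2
      exact Or.inr ⟨rfl, h2⟩
    · exact absurd (h1 _ h) hlc

variable (K) in
/-- The rank `2` valuation of `K((t^ℚ))((u))`, composed of the `u`-adic and the `t`-adic
valuations. -/
def lexVal : AddValuation (USeries K) (WithTop (ℤ ×ₗ ℚ)) :=
  AddValuation.of lexOrder lexOrder_zero
    (by
      rw [lexOrder_of_ne one_ne_zero, HahnSeries.leadingCoeff_one, HahnSeries.order_one,
        HahnSeries.order_one]
      rfl)
    (by
      intro x y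
      have key : ∀ γ, γ ≤ lexOrder x → γ ≤ lexOrder y → γ ≤ lexOrder (x + y) := by
        intro γ hx hy
        rcases eq_top_or_lexPair γ with rfl | ⟨n, δ, rfl⟩
        · have h0 : ∀ z : USeries K, ⊤ ≤ lexOrder z → z = 0 := by
            intro z hz
            by_contra hne
            rw [lexOrder_of_ne hne, top_le_iff] at hz
            exact WithTop.coe_ne_top hz
          rw [h0 x hx, h0 y hy, add_zero, lexOrder_zero]
        · rw [lexPair_le_lexOrder] at hx hy ⊢
          refine ⟨fun m hm => ?_, ?_⟩
          · rw [HahnSeries.coeff_add, hx.1 m hm, hy.1 m hm, add_zero]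
          · rw [HahnSeries.coeff_add]
            exact AddValuation.map_le_add _ hx.2 hy.2
      exact key _ (min_le_left _ _) (min_le_right _ _))
    (by
      intro x y
      by_cases hx : x = 0
      · rw [hx, zero_mul, lexOrder_zero, top_add]
      by_cases hy : y = 0
      · rw [hy, mul_zero, lexOrder_zero, add_top]
      rw [lexOrder_of_ne hx, lexOrder_of_ne hy, lexOrder_of_ne (mul_ne_zero hx hy),
        HahnSeries.leadingCoeff_mul, HahnSeries.order_mul hx hy,
        HahnSeries.order_mul (HahnSeries.leadingCoeff_ne_zero.2 hx)
          (HahnSeries.leadingCoeff_ne_zero.2 hy), lexPair_add])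

theorem lexVal_apply (x : USeries K) : lexVal K x = lexOrder x := rfl

theorem lexVal_eq_iff {x : USeries K} {n : ℤ} {δ : ℚ} : lexVal K x = lexPair n δ ↔
    (∀ m < n, x.coeff m = 0) ∧ tVal K (x.coeff n) = (δ : WithTop ℚ) := by
  rw [lexVal_apply]
  constructor
  · intro h
    have h1 := lexPair_le_lexOrder.1 h.ge
    refine ⟨h1.1, le_antisymm ?_ h1.2⟩
    by_contra hlt
    rw [not_le] at hlt
    obtain ⟨ε, hε⟩ : ∃ ε : ℚ, δ < ε ∧ (ε : WithTop ℚ) ≤ tVal K (x.coeff n) := by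
      cases hc : tVal K (x.coeff n) with
      | top => exact ⟨δ + 1, by linarith, le_top⟩
      | coe ε => rw [hc] at hlt; exact ⟨ε, WithTop.coe_lt_coe.1 hlt, le_rfl⟩
    have h2 := lexPair_le_lexOrder.2 ⟨h1.1, hε.2⟩
    rw [h, lexPair_le_lexPair] at h2
    rcases h2 with h2 | ⟨-, h2⟩
    · exact lt_irrefl _ h2
    · exact absurd h2 (not_le.2 hε.1)
  · rintro ⟨h1, h2⟩
    have h3 := lexPair_le_lexOrder.2 ⟨h1, h2.ge⟩
    rcases eq_top_or_lexPair (lexOrder x) with h | ⟨m, ε, h⟩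
    · have h4 := (AddValuation.top_iff (lexVal K)).1 h
      rw [h4, HahnSeries.coeff_zero, AddValuation.map_zero] at h2
      exact absurd h2 WithTop.top_ne_coe
    · have h4 := lexPair_le_lexOrder.1 h.ge
      rw [h, lexPair_le_lexPair] at h3
      rcases h3 with h3 | ⟨rfl, h3⟩
      · rw [h4.1 n h3, AddValuation.map_zero] at h2
        exact absurd h2 WithTop.top_ne_coe
      · rw [h2] at h4
        rw [h, le_antisymm h3 (WithTop.coe_le_coe.1 h4.2)]

theorem lexVal_single {n : ℤ} {δ : ℚ} {h : HahnSeries ℚ K} (hh : tVal K h = (δ : WithTop ℚ)) :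
    lexVal K (HahnSeries.single n h) = lexPair n δ := by
  rw [lexVal_eq_iff]
  refine ⟨fun m hm => HahnSeries.coeff_single_of_ne hm.ne, ?_⟩
  rw [HahnSeries.coeff_single_same, hh]

theorem addVal_eq_map_fst (x : USeries K) :
    HahnSeries.addVal ℤ (HahnSeries ℚ K) x = (lexVal K x).map fun γ => (ofLex γ).1 := by
  rw [lexVal_apply]
  by_cases hx : x = 0
  · rw [hx, AddValuation.map_zero, lexOrder_zero]; rfl
  · rw [HahnSeries.addVal_apply_of_ne hx, lexOrder_of_ne hx]; rfl

theorem tVal_coeff_zero_eq_map_snd {x : USeries K}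
    (hx : HahnSeries.addVal ℤ (HahnSeries ℚ K) x = 0) :
    tVal K (x.coeff 0) = (lexVal K x).map fun γ => (ofLex γ).2 := by
  rcases eq_top_or_lexPair (lexVal K x) with h | ⟨n, δ, h⟩
  · rw [addVal_eq_map_fst, h] at hx
    exact absurd hx WithTop.top_ne_zero
  · rw [addVal_eq_map_fst, h] at hx
    have hn : n = 0 := WithTop.coe_injective hx
    subst hn
    rw [h, (lexVal_eq_iff.1 h).2]
    rfl

/-- The first component of a value is nonnegative as soon as the value is. -/
theorem addVal_nonneg_of_lexVal {x : USeries K} (hx : 0 ≤ lexVal K x) :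
    0 ≤ HahnSeries.addVal ℤ (HahnSeries ℚ K) x := by
  rw [addVal_eq_map_fst]
  rcases eq_top_or_lexPair (lexVal K x) with h | ⟨n, δ, h⟩
  · rw [h]; exact le_top
  · rw [h, ← lexPair_zero, lexPair_le_lexPair] at hx
    rw [h]
    exact WithTop.coe_le_coe.2 (by omega : 0 ≤ n)

theorem addVal_pos_iff {x : USeries K} (hx : 0 ≤ HahnSeries.addVal ℤ (HahnSeries ℚ K) x) :
    0 < HahnSeries.addVal ℤ (HahnSeries ℚ K) x ↔ x.coeff 0 = 0 := by
  constructor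
  · intro h
    rw [HahnSeries.addVal_apply] at h
    exact HahnSeries.coeff_eq_zero_of_lt_orderTop h
  · intro h
    refine lt_of_le_of_ne hx fun h0 => ?_
    rw [HahnSeries.addVal_apply] at h0
    exact HahnSeries.coeff_orderTop_ne h0.symm h

/-- Taking the constant coefficient is multiplicative on the series without polar part. -/
theorem coeff_zero_mul {x y : USeries K} (hx : 0 ≤ HahnSeries.addVal ℤ (HahnSeries ℚ K) x)
    (hy : 0 ≤ HahnSeries.addVal ℤ (HahnSeries ℚ K) y) :
    (x * y).coeff 0 = x.coeff 0 * y.coeff 0 := by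
  set w := HahnSeries.addVal ℤ (HahnSeries ℚ K)
  have hC : ∀ h : HahnSeries ℚ K, 0 ≤ w (HahnSeries.C h) := fun h => by
    change 0 ≤ HahnSeries.addVal ℤ (HahnSeries ℚ K) _
    rw [HahnSeries.addVal_apply]
    exact HahnSeries.orderTop_single_le
  have hsub : ∀ z, 0 ≤ w z → 0 < w (z - HahnSeries.C (z.coeff 0)) := fun z hz => by
    refine (addVal_pos_iff ?_).2 ?_
    · rw [sub_eq_add_neg]
      refine AddValuation.map_le_add _ hz ?_
      rw [AddValuation.map_neg]
      exact hC _
    · simp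
  -- modulo series of positive order, `x` and `y` are their constant coefficients
  have h1 : x * y - HahnSeries.C (x.coeff 0 * y.coeff 0) =
      (x - HahnSeries.C (x.coeff 0)) * y +
        HahnSeries.C (x.coeff 0) * (y - HahnSeries.C (y.coeff 0)) := by
    rw [map_mul]; ring
  have h2 : 0 < w (x * y - HahnSeries.C (x.coeff 0 * y.coeff 0)) := by
    rw [h1]
    refine AddValuation.map_lt_add _ ?_ ?_
    · rw [AddValuation.map_mul]
      exact (hsub x hx).trans_le (le_add_of_nonneg_right hy)
    · rw [AddValuation.map_mul]
      exact (hsub y hy).trans_le (le_add_of_nonneg_left (hC _))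
  have h3 := (addVal_pos_iff h2.le).1 h2
  rw [HahnSeries.coeff_sub, sub_eq_zero] at h3
  rw [h3]
  simp

end LexVal

section Composite

variable {K : Type*} [Field K] {L : Type*} [Field L] (Φ : L →+* USeries K)

/-- The `u`-adic valuation of a subfield of `K((t^ℚ))((u))`. -/
abbrev uVal : AddValuation L (WithTop ℤ) := (HahnSeries.addVal ℤ (HahnSeries ℚ K)).comap Φ

/-- The constant coefficient, on the `u`-adic valuation ring. -/
def coeffHom : valRing (uVal Φ) →+* HahnSeries ℚ K where
  toFun a := (Φ a).coeff 0
  map_one' := by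
    rw [OneMemClass.coe_one, map_one, HahnSeries.coeff_one, if_pos rfl]
  map_mul' a b := by
    rw [MulMemClass.coe_mul, map_mul]
    exact coeff_zero_mul a.2 b.2
  map_zero' := by rw [ZeroMemClass.coe_zero, map_zero, HahnSeries.coeff_zero]
  map_add' a b := by rw [AddMemClass.coe_add, map_add, HahnSeries.coeff_add]

instance isLocalHom_coeffHom : IsLocalHom (coeffHom Φ) where
  map_nonunit a ha := by
    rw [isUnit_valRing_iff]
    refine le_antisymm (not_lt.1 fun h => ?_) a.2
    exact ha.ne_zero ((addVal_pos_iff a.2).1 h)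

/-- The embedding in `K((t^ℚ))` of the residue field of the `u`-adic valuation. -/
def resHom : IsLocalRing.ResidueField (valRing (uVal Φ)) →+* HahnSeries ℚ K :=
  IsLocalRing.ResidueField.lift (coeffHom Φ)

theorem resHom_residue (a : valRing (uVal Φ)) :
    resHom Φ (IsLocalRing.residue (valRing (uVal Φ)) a) = (Φ a).coeff 0 := rfl

theorem isComposite_lexVal :
    IsComposite ((lexVal K).comap Φ) (uVal Φ) ((tVal K).comap (resHom Φ)) :=
  ⟨fun f => addVal_eq_map_fst (Φ f), fun f hf => tVal_coeff_zero_eq_map_snd (x := Φ f) hf⟩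

theorem exists_resHom_residue_eq {x : L} {h : HahnSeries ℚ K} (hx : Φ x = HahnSeries.C h) :
    ∃ hm : x ∈ valRing (uVal Φ),
      resHom Φ (IsLocalRing.residue (valRing (uVal Φ)) ⟨x, hm⟩) = h := by
  refine ⟨?_, ?_⟩
  · change 0 ≤ HahnSeries.addVal ℤ (HahnSeries ℚ K) (Φ x)
    rw [hx, HahnSeries.addVal_apply]
    exact HahnSeries.orderTop_single_le
  · rw [resHom_residue]
    change (Φ x).coeff 0 = h
    rw [hx]
    simp

end Composite

/-! ### The substitution `v = z u` -/

section FourVariables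

variable {K : Type*} [Field K]

open MvPolynomial in
variable (K) in
/-- The substitution `u ↦ U`, `v ↦ z U`, from `K[x, y, u, v]` to `K[x, y, z][U]`. -/
def blowUp : MvPolynomial (Fin 4) K →ₐ[K] Polynomial (MvPolynomial (Fin 3) K) :=
  aeval ![Polynomial.C (X 0), Polynomial.C (X 1), Polynomial.X, Polynomial.C (X 2) * Polynomial.X]

open MvPolynomial in
theorem blowUp_injective : Function.Injective (blowUp K) := by
  -- the substitution `z ↦ v / u`, `U ↦ u` is inverse to it
  let ψ : Polynomial (MvPolynomial (Fin 3) K) →+* FunField (Fin 4) K :=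
    Polynomial.eval₂RingHom
      (aeval (R := K) ![(ratFun (X 0) : FunField (Fin 4) K), ratFun (X 1),
        ratFun (X 3) / ratFun (X 2)]).toRingHom (ratFun (X 2))
  have h2 : (ratFun (X 2) : FunField (Fin 4) K) ≠ 0 := ratFun_ne_zero.2 (X_ne_zero 2)
  have hψ : ψ.comp (blowUp K : MvPolynomial (Fin 4) K →+* Polynomial (MvPolynomial (Fin 3) K)) =
      algebraMap (MvPolynomial (Fin 4) K) (FunField (Fin 4) K) := by
    refine ringHom_ext (fun c => ?_) fun i => ?_
    · have : algebraMap (MvPolynomial (Fin 4) K) (FunField (Fin 4) K) (C c) =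
          algebraMap K (FunField (Fin 4) K) c :=
        (IsScalarTower.algebraMap_apply K (MvPolynomial (Fin 4) K) (FunField (Fin 4) K) c).symm
      rw [this]
      simp [blowUp, ψ]
    · fin_cases i
      · simp [blowUp, ψ]; rfl
      · simp [blowUp, ψ]; rfl
      · simp [blowUp, ψ]; rfl
      · simp [blowUp, ψ, h2]; rfl
  intro p q hpq
  refine ratFun_injective (?_ : algebraMap _ (FunField (Fin 4) K) p = algebraMap _ _ q)
  rw [← hψ, RingHom.comp_apply, RingHom.comp_apply]
  exact congrArg ψ hpq

open MvPolynomial in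
/-- The degree in `z` of the coefficient of `U ^ n` is at most `n`. -/
theorem degreeOf_coeff_blowUp_le (p : MvPolynomial (Fin 4) K) (n : ℕ) :
    degreeOf 2 ((blowUp K p).coeff n) ≤ n := by
  induction p using MvPolynomial.induction_on generalizing n with
  | C c =>
    have : blowUp K (C c) = Polynomial.C (C c) := by
      rw [← algebraMap_eq, AlgHom.commutes]; rfl
    rw [this, Polynomial.coeff_C]
    split_ifs <;> simp
  | add p q hp hq =>
    rw [map_add, Polynomial.coeff_add]
    exact (degreeOf_add_le _ _ _).trans (max_le (hp n) (hq n))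
  | mul_X p i hp =>
    rw [map_mul]
    have hC : ∀ j : Fin 3, j ≠ 2 →
        degreeOf 2 ((blowUp K p * Polynomial.C (X j)).coeff n) ≤ n := by
      intro j hj
      rw [Polynomial.coeff_mul_C]
      refine (degreeOf_mul_le _ _ _).trans ?_
      rw [degreeOf_X_of_ne hj.symm]
      exact hp n
    have hX : degreeOf 2 ((blowUp K p * Polynomial.X).coeff n) ≤ n - 1 := by
      cases n with
      | zero => simp
      | succ n => rw [Polynomial.coeff_mul_X]; exact hp n
    have hb : blowUp K (X i) = ![Polynomial.C (X 0), Polynomial.C (X 1), Polynomial.X,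
        Polynomial.C (X 2) * Polynomial.X] i := aeval_X _ _
    rw [hb]
    fin_cases i
    · exact hC 0 (by decide)
    · exact hC 1 (by decide)
    · exact hX.trans (Nat.sub_le n 1)
    · change degreeOf 2 ((blowUp K p * (Polynomial.C (X 2) * Polynomial.X)).coeff n) ≤ n
      rw [mul_left_comm, Polynomial.coeff_C_mul]
      cases n with
      | zero => simp
      | succ n =>
        refine (degreeOf_mul_le _ _ _).trans ?_
        rw [degreeOf_X, if_pos rfl, add_comm]
        exact Nat.add_le_add_right hX 1

open MvPolynomial in
/-- Homogenization with respect to `z = v / u`. -/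
theorem exists_blowUp_eq_monomial {q : MvPolynomial (Fin 3) K} {n : ℕ} (hq : degreeOf 2 q ≤ n) :
    ∃ p, blowUp K p = Polynomial.monomial n q := by
  rw [degreeOf_le_iff] at hq
  have hmon : ∀ s ∈ q.support, ∃ p,
      blowUp K p = Polynomial.monomial n (monomial s (coeff s q)) := by
    intro s hs
    refine ⟨C (coeff s q) * X 0 ^ s 0 * X 1 ^ s 1 * X 2 ^ (n - s 2) * X 3 ^ s 2, ?_⟩
    have hb : ∀ i, blowUp K (X i) = ![Polynomial.C (X 0), Polynomial.C (X 1), Polynomial.X,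
        Polynomial.C (X 2) * Polynomial.X] i := fun i => aeval_X _ _
    have hC : ∀ c, blowUp K (C c) = Polynomial.C (C c) := fun c => by
      rw [← algebraMap_eq, AlgHom.commutes]; rfl
    have hn : n = (n - s 2) + s 2 := (Nat.sub_add_cancel (hq s hs)).symm
    have hm : monomial s (coeff s q) = C (coeff s q) * (X 0 ^ s 0 * X 1 ^ s 1 * X 2 ^ s 2) := by
      rw [monomial_eq, Finsupp.prod_fintype _ _ fun i => pow_zero _, Fin.prod_univ_three]
    rw [← Polynomial.C_mul_X_pow_eq_monomial, hm]
    conv_rhs => rw [hn, pow_add]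
    simp only [map_mul, map_pow, hb, hC]
    simp only [Matrix.cons_val]
    rw [mul_pow]
    ring
  choose! P hP using hmon
  refine ⟨∑ s ∈ q.support, P s, ?_⟩
  rw [map_sum, Finset.sum_congr rfl hP, ← map_sum, support_sum_monomial_coeff]

end FourVariables

/-! ### The rank two valuation of `K(x, y, u, v)` -/

section RankTwo

variable {K : Type*} [Field K] {ι : FunField (Fin 2) K →ₐ[K] HahnSeries ℚ K}
  {z : HahnSeries ℚ K}

variable (ι z) in
/-- The homomorphism `K[x, y, z][U] → K((t^ℚ))((u))` which evaluates the coefficients in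
`K((t^ℚ))` and sends `U` to `u`. -/
def seriesMap : Polynomial (MvPolynomial (Fin 3) K) →+* USeries K :=
  ((HahnSeries.ofPowerSeries ℤ (HahnSeries ℚ K)).comp Polynomial.coeToPowerSeries.ringHom).comp
    (Polynomial.mapRingHom (evalZ ι z : MvPolynomial (Fin 3) K →+* HahnSeries ℚ K))

theorem coeff_seriesMap (Q : Polynomial (MvPolynomial (Fin 3) K)) (n : ℕ) :
    (seriesMap ι z Q).coeff (n : ℤ) = evalZ ι z (Q.coeff n) := by
  change (HahnSeries.ofPowerSeries ℤ (HahnSeries ℚ K) _).coeff (n : ℤ) = _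
  rw [HahnSeries.ofPowerSeries_apply_coeff]
  simp

theorem seriesMap_monomial (n : ℕ) (q : MvPolynomial (Fin 3) K) :
    seriesMap ι z (Polynomial.monomial n q) = HahnSeries.single (n : ℤ) (evalZ ι z q) := by
  rw [← Polynomial.C_mul_X_pow_eq_monomial]
  simp [seriesMap]

theorem seriesMap_C (q : MvPolynomial (Fin 3) K) :
    seriesMap ι z (Polynomial.C q) = HahnSeries.C (evalZ ι z q) := by
  simp [seriesMap]

theorem seriesMap_injective (hinj : Function.Injective (evalZ ι z)) :
    Function.Injective (seriesMap ι z) :=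
  HahnSeries.ofPowerSeries_injective.comp
    ((Polynomial.coe_injective _).comp (Polynomial.map_injective _ hinj))

theorem algebraMap_uSeries (c : K) :
    algebraMap K (USeries K) c = HahnSeries.C (algebraMap K (HahnSeries ℚ K) c) := by
  rw [HahnSeries.algebraMap_apply', PowerSeries.algebraMap_apply, HahnSeries.ofPowerSeries_C]

theorem blowUp_C (c : K) :
    blowUp K (MvPolynomial.C c) = Polynomial.C (MvPolynomial.C c) := by
  rw [← MvPolynomial.algebraMap_eq, AlgHom.commutes]; rfl

variable (ι z) in
/-- The homomorphism `K[x, y, u, v] → K((t^ℚ))((u))` with `v ↦ z u`. -/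
def polyToUSeries : MvPolynomial (Fin 4) K →ₐ[K] USeries K :=
  { (seriesMap ι z).comp (blowUp K : MvPolynomial (Fin 4) K →+* _) with
    commutes' := fun c => by
      change seriesMap ι z (blowUp K (MvPolynomial.C c)) = _
      rw [blowUp_C, seriesMap_C, algebraMap_uSeries, ← MvPolynomial.algebraMap_eq,
        AlgHom.commutes] }

/-- The embedding of `K(x, y, u, v)` in `K((t^ℚ))((u))` with `v ↦ z u`. -/
def funToUSeries (hinj : Function.Injective (evalZ ι z)) : FunField (Fin 4) K →ₐ[K] USeries K :=
  liftFun (polyToUSeries ι z) ((seriesMap_injective hinj).comp blowUp_injective)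

theorem funToUSeries_ratFun (hinj : Function.Injective (evalZ ι z)) (p : MvPolynomial (Fin 4) K) :
    funToUSeries hinj (ratFun p) = seriesMap ι z (blowUp K p) := liftFun_ratFun _ _ p

theorem trivialOn_lexVal : TrivialOn K (lexVal K) := fun c => by
  rw [algebraMap_uSeries, ← lexPair_zero]
  refine lexPair_le_lexOrder.2 ⟨fun m hm => HahnSeries.coeff_single_of_ne hm.ne, ?_⟩
  rw [HahnSeries.C_apply, HahnSeries.coeff_single_same]
  exact trivialOn_tVal K c

theorem lexPair_le_lexVal_single {n : ℤ} {δ : ℚ} {h : HahnSeries ℚ K}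
    (hh : (δ : WithTop ℚ) ≤ tVal K h) : lexPair n δ ≤ lexVal K (HahnSeries.single n h) := by
  refine lexPair_le_lexOrder.2 ⟨fun m hm => HahnSeries.coeff_single_of_ne hm.ne, ?_⟩
  rwa [HahnSeries.coeff_single_same]

theorem evalZ_X_two : evalZ ι z (MvPolynomial.X 2) = z := by
  rw [evalZ, MvPolynomial.aeval_X]; rfl

theorem funToUSeries_X_two (hinj : Function.Injective (evalZ ι z)) :
    funToUSeries hinj (ratFun (MvPolynomial.X 2)) = HahnSeries.single 1 1 := by
  have h : blowUp K (MvPolynomial.X 2) = Polynomial.monomial 1 1 :=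
    (MvPolynomial.aeval_X _ _).trans Polynomial.monomial_one_one_eq_X.symm
  rw [funToUSeries_ratFun, h, seriesMap_monomial, map_one]
  rfl

theorem funToUSeries_X_three (hinj : Function.Injective (evalZ ι z)) :
    funToUSeries hinj (ratFun (MvPolynomial.X 3)) = HahnSeries.single 1 z := by
  have h : blowUp K (MvPolynomial.X 3) = Polynomial.monomial 1 (MvPolynomial.X 2) :=
    (MvPolynomial.aeval_X _ _).trans (Polynomial.C_mul_X_eq_monomial)
  rw [funToUSeries_ratFun, h, seriesMap_monomial, evalZ_X_two]
  rfl

theorem blowUp_rename (p : MvPolynomial (Fin 2) K) :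
    blowUp K (MvPolynomial.rename (Fin.castLE (by decide : 2 ≤ 4)) p) =
      Polynomial.C (MvPolynomial.rename Fin.castSucc p) := by
  have h : (blowUp K : MvPolynomial (Fin 4) K →+* Polynomial (MvPolynomial (Fin 3) K)).comp
      (MvPolynomial.rename (R := K) (Fin.castLE (by decide : 2 ≤ 4))).toRingHom =
      Polynomial.C.comp
        (MvPolynomial.rename (R := K) (Fin.castSucc : Fin 2 → Fin 3)).toRingHom := by
    refine MvPolynomial.ringHom_ext (fun c => ?_) fun i => ?_
    · simp
    · fin_cases i <;> simp [blowUp]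
  exact RingHom.congr_fun h p

theorem funToUSeries_rename (hinj : Function.Injective (evalZ ι z)) (p : MvPolynomial (Fin 2) K) :
    funToUSeries hinj (ratFun (MvPolynomial.rename (Fin.castLE (by decide : 2 ≤ 4)) p)) =
      HahnSeries.C (ι (ratFun p)) := by
  rw [funToUSeries_ratFun, blowUp_rename, seriesMap_C, evalZ_rename]

/-- Every element of `K(x, y)` is the image of an element of `K(x, y, u, v)`. -/
theorem exists_funToUSeries_eq_C (hinj : Function.Injective (evalZ ι z)) (r : FunField (Fin 2) K) :
    ∃ s, funToUSeries hinj s = HahnSeries.C (ι r) := by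
  obtain ⟨f, g, -, rfl⟩ := exists_ratFun_div r
  refine ⟨ratFun (MvPolynomial.rename (Fin.castLE (by decide : 2 ≤ 4)) f) /
    ratFun (MvPolynomial.rename (Fin.castLE (by decide : 2 ≤ 4)) g), ?_⟩
  rw [map_div₀, funToUSeries_rename, funToUSeries_rename, map_div₀, map_div₀]

theorem IsAdmissible.funToUSeries_X_pos (hι : IsAdmissible ι)
    (hinj : Function.Injective (evalZ ι z)) (hz : 0 < tVal K z) (i : Fin 4) :
    0 < lexVal K (funToUSeries hinj (ratFun (MvPolynomial.X i))) := by
  have hxy : ∀ j : Fin 2, 0 < lexVal K (funToUSeries hinj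
      (ratFun (MvPolynomial.X (Fin.castLE (by decide : 2 ≤ 4) j)))) := by
    intro j
    obtain ⟨s, hs⟩ := exists_coe_val_ratFun (ι := ι) (MvPolynomial.X_ne_zero (R := K) j)
    have hs' : tVal K (ι (ratFun (MvPolynomial.X j))) = (s : WithTop ℚ) := hs
    have hpos := hι.X_pos j
    rw [hs'] at hpos
    rw [← MvPolynomial.rename_X, funToUSeries_rename]
    have h1 : lexVal K (HahnSeries.C (ι (ratFun (MvPolynomial.X j)))) = lexPair 0 s :=
      lexVal_single hs'
    rw [h1, ← lexPair_zero, lexPair_lt_lexPair]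
    exact Or.inr ⟨rfl, WithTop.coe_lt_coe.1 hpos⟩
  have h10 : (0 : WithTop (ℤ ×ₗ ℚ)) < lexPair 1 0 := by
    rw [← lexPair_zero, lexPair_lt_lexPair]; exact Or.inl one_pos
  fin_cases i
  · exact hxy 0
  · exact hxy 1
  · change 0 < lexVal K (funToUSeries hinj (ratFun (MvPolynomial.X 2)))
    rw [funToUSeries_X_two]
    refine h10.trans_le (lexPair_le_lexVal_single ?_)
    rw [AddValuation.map_one]; rfl
  · change 0 < lexVal K (funToUSeries hinj (ratFun (MvPolynomial.X 3)))
    rw [funToUSeries_X_three]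
    exact h10.trans_le (lexPair_le_lexVal_single hz.le)

/-- The inclusion of `K[x, y, u, v]_{(x, y, u, v)}` in `K((t^ℚ))((u))`. -/
abbrev locToUSeries (hinj : Function.Injective (evalZ ι z)) : LocRing (Fin 4) K →ₐ[K] USeries K :=
  (funToUSeries hinj).comp (IsScalarTower.toAlgHom K (LocRing (Fin 4) K) (FunField (Fin 4) K))

theorem locToUSeries_algebraMap (hinj : Function.Injective (evalZ ι z))
    (p : MvPolynomial (Fin 4) K) :
    locToUSeries hinj (algebraMap _ _ p) = seriesMap ι z (blowUp K p) :=
  funToUSeries_ratFun hinj p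

theorem IsAdmissible.dominates_lexVal (hι : IsAdmissible ι)
    (hinj : Function.Injective (evalZ ι z)) (hz : 0 < tVal K z) :
    Dominates ((lexVal K).comap (funToUSeries hinj : FunField (Fin 4) K →+* USeries K))
      (algebraMap (LocRing (Fin 4) K) (FunField (Fin 4) K)) := by
  have h := dominates_locRing trivialOn_lexVal (locToUSeries hinj)
    ((funToUSeries hinj).toRingHom.injective.comp
      (IsFractionRing.injective (LocRing (Fin 4) K) (FunField (Fin 4) K)))
    (fun i => hι.funToUSeries_X_pos hinj hz i)
  exact ⟨IsFractionRing.injective _ _, h.2.1, h.2.2⟩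

theorem hasValueGroup_lexVal (hι : IsAdmissible ι) (hinj : Function.Injective (evalZ ι z)) :
    HasValueGroup ((lexVal K).comap (funToUSeries hinj : FunField (Fin 4) K →+* USeries K)) := by
  intro γ
  obtain ⟨r, hr⟩ := hι.2 (ofLex γ).2
  obtain ⟨s, hs⟩ := exists_funToUSeries_eq_C hinj r
  refine ⟨ratFun (MvPolynomial.X 2) ^ (ofLex γ).1 * s, ?_⟩
  change lexVal K (funToUSeries hinj (ratFun (MvPolynomial.X 2) ^ (ofLex γ).1 * s)) = _
  rw [map_mul, map_zpow₀, funToUSeries_X_two, hs, HahnSeries.C_apply]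
  have h1 : (HahnSeries.single (1 : ℤ) (1 : HahnSeries ℚ K)) ^ (ofLex γ).1 =
      HahnSeries.single (ofLex γ).1 1 := (RatFunc.single_zpow _).symm
  rw [h1, HahnSeries.single_mul_single, add_zero, one_mul]
  exact lexVal_single hr

theorem hasValueGroup_uVal {L : Type*} [Field L] {Φ : L →+* USeries K}
    (h : HasValueGroup ((lexVal K).comap Φ)) : HasValueGroup (uVal Φ) := fun n => by
  obtain ⟨f, hf⟩ := h (toLex (n, 0))
  exact ⟨f, (addVal_eq_map_fst (Φ f)).trans (congrArg _ hf)⟩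

theorem hasValueGroup_resHom {L : Type*} [Field L] {Φ : L →+* USeries K}
    (h : HasValueGroup ((lexVal K).comap Φ)) : HasValueGroup ((tVal K).comap (resHom Φ)) := by
  intro δ
  obtain ⟨f, hf⟩ := h (toLex (0, δ))
  have h0 : uVal Φ f = 0 := (addVal_eq_map_fst (Φ f)).trans (congrArg _ hf)
  exact ⟨IsLocalRing.residue _ ⟨f, h0.ge⟩, (tVal_coeff_zero_eq_map_snd h0).trans (congrArg _ hf)⟩

open MvPolynomial in
variable (K) in
/-- The substitution `u, v ↦ 0`. -/
def killUV : MvPolynomial (Fin 4) K →ₐ[K] MvPolynomial (Fin 2) K := aeval ![X 0, X 1, 0, 0]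

theorem constantCoeff_killUV (p : MvPolynomial (Fin 4) K) :
    MvPolynomial.constantCoeff (killUV K p) = MvPolynomial.constantCoeff p := by
  have h : MvPolynomial.constantCoeff.comp
      (killUV K : MvPolynomial (Fin 4) K →+* MvPolynomial (Fin 2) K) =
        MvPolynomial.constantCoeff := by
    refine MvPolynomial.ringHom_ext (fun c => ?_) fun i => ?_
    · simp [killUV]
    · fin_cases i <;> simp [killUV]
  exact RingHom.congr_fun h p

theorem coeff_zero_blowUp (p : MvPolynomial (Fin 4) K) :
    (blowUp K p).coeff 0 = MvPolynomial.rename Fin.castSucc (killUV K p) := by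
  have h : Polynomial.constantCoeff.comp
      (blowUp K : MvPolynomial (Fin 4) K →+* Polynomial (MvPolynomial (Fin 3) K)) =
        ((MvPolynomial.rename (Fin.castSucc : Fin 2 → Fin 3)).comp (killUV K)).toRingHom := by
    refine MvPolynomial.ringHom_ext (fun c => ?_) fun i => ?_
    · simp [killUV, blowUp, Polynomial.algebraMap_apply]
    · fin_cases i <;> simp [killUV, blowUp]
  exact RingHom.congr_fun h p

theorem killUV_rename (p : MvPolynomial (Fin 2) K) :
    killUV K (MvPolynomial.rename (Fin.castLE (by decide : 2 ≤ 4)) p) = p := by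
  have h : (killUV K).comp (MvPolynomial.rename (Fin.castLE (by decide : 2 ≤ 4))) =
      AlgHom.id K _ := by
    refine MvPolynomial.algHom_ext fun i => ?_
    rw [AlgHom.comp_apply, MvPolynomial.rename_X, killUV, MvPolynomial.aeval_X]
    fin_cases i <;> rfl
  exact DFunLike.congr_fun h p

variable (K) in
/-- The substitution `u, v ↦ 0` on the local rings. -/
def locKillUV : LocRing (Fin 4) K →ₐ[K] LocRing (Fin 2) K :=
  IsLocalization.liftAlgHom (M := (MvPolynomial.idealOfVars (Fin 4) K).primeCompl)
    (f := (IsScalarTower.toAlgHom K (MvPolynomial (Fin 2) K) (LocRing (Fin 2) K)).comp (killUV K))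
    fun y => isUnit_algebraMap_locRing.2 (by
      change MvPolynomial.constantCoeff (killUV K y) ≠ 0
      rw [constantCoeff_killUV]
      exact fun h => y.2 ((mem_idealOfVars_iff _).2 h))

theorem locKillUV_algebraMap (p : MvPolynomial (Fin 4) K) :
    locKillUV K (algebraMap _ _ p) = algebraMap _ _ (killUV K p) :=
  IsLocalization.lift_eq _ p

theorem locKillUV_surjective : Function.Surjective (locKillUV K) := by
  intro b
  obtain ⟨p, s, hs, h⟩ := exists_mul_eq_algebraMap b
  set p' := MvPolynomial.rename (Fin.castLE (by decide : 2 ≤ 4)) p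
  set s' := MvPolynomial.rename (Fin.castLE (by decide : 2 ≤ 4)) s with hs'
  have hu : IsUnit (algebraMap _ (LocRing (Fin 4) K) s') := isUnit_algebraMap_locRing.2 (by
    rwa [← constantCoeff_killUV, hs', killUV_rename])
  refine ⟨algebraMap _ _ p' * ↑(hu.unit⁻¹), ?_⟩
  have h1 : algebraMap _ _ p' * ↑(hu.unit⁻¹) * algebraMap _ _ s' =
      algebraMap _ (LocRing (Fin 4) K) p' := by rw [mul_assoc, hu.val_inv_mul, mul_one]
  have h2 := congrArg (locKillUV K) h1
  have hkp : killUV K p' = p := killUV_rename p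
  have hks : killUV K s' = s := killUV_rename s
  rw [map_mul, locKillUV_algebraMap, locKillUV_algebraMap, hkp, hks, ← h] at h2
  exact (isUnit_algebraMap_locRing.2 hs).mul_right_cancel h2

/-- The constant coefficient in `u` of an element of `K[x, y, u, v]_{(x, y, u, v)}` is obtained by
`u, v ↦ 0`. -/
theorem IsAdmissible.coeff_zero_locToUSeries (hι : IsAdmissible ι)
    (hinj : Function.Injective (evalZ ι z)) (hz : 0 < tVal K z) (a : LocRing (Fin 4) K) :
    (locToUSeries hinj a).coeff 0 = ι (algebraMap _ _ (locKillUV K a)) := by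
  have hnn : ∀ b : LocRing (Fin 4) K,
      0 ≤ HahnSeries.addVal ℤ (HahnSeries ℚ K) (locToUSeries hinj b) := fun b =>
    addVal_nonneg_of_lexVal ((hι.dominates_lexVal hinj hz).2.2 b).1
  have hpoly : ∀ p : MvPolynomial (Fin 4) K, (locToUSeries hinj (algebraMap _ _ p)).coeff 0 =
      ι (algebraMap _ _ (locKillUV K (algebraMap _ _ p))) := by
    intro p
    have h1 := coeff_seriesMap (ι := ι) (z := z) (blowUp K p) 0
    rw [coeff_zero_blowUp, evalZ_rename] at h1
    rw [locToUSeries_algebraMap, locKillUV_algebraMap]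
    exact h1
  obtain ⟨p, s, hs, h⟩ := exists_mul_eq_algebraMap a
  have h1 : (locToUSeries hinj a).coeff 0 * (locToUSeries hinj (algebraMap _ _ s)).coeff 0 =
      (locToUSeries hinj (algebraMap _ _ p)).coeff 0 := by
    rw [← coeff_zero_mul (hnn a) (hnn _), ← map_mul, h]
  rw [hpoly, hpoly, ← h, map_mul, map_mul, map_mul] at h1
  refine mul_right_cancel₀ ?_ h1
  exact (((((isUnit_algebraMap_locRing.2 hs).map (locKillUV K))).map
    (algebraMap (LocRing (Fin 2) K) (FunField (Fin 2) K))).map ι).ne_zero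

/-- The center of the `u`-adic valuation is the kernel of `u, v ↦ 0`. -/
theorem IsAdmissible.uVal_pos_iff (hι : IsAdmissible ι)
    (hinj : Function.Injective (evalZ ι z)) (hz : 0 < tVal K z) (a : LocRing (Fin 4) K) :
    0 < uVal (funToUSeries hinj : FunField (Fin 4) K →+* USeries K) (algebraMap _ _ a) ↔
      locKillUV K a = 0 := by
  have h := addVal_pos_iff (addVal_nonneg_of_lexVal ((hι.dominates_lexVal hinj hz).2.2 a).1)
  refine h.trans ?_
  change (locToUSeries hinj a).coeff 0 = 0 ↔ _
  rw [hι.coeff_zero_locToUSeries hinj hz, map_eq_zero_iff ι ι.toRingHom.injective,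
    map_eq_zero_iff _ (IsFractionRing.injective (LocRing (Fin 2) K) (FunField (Fin 2) K))]

/-- The values of the elements of `K[x, y, u, v]_{(x, y, u, v)}` of `u`-adic value `n` are given by
the polynomials of degree at most `n` in `z`. -/
theorem IsAdmissible.sliceValues_eq (hι : IsAdmissible ι) (hinj : Function.Injective (evalZ ι z))
    (hz : 0 < tVal K z) (n : ℕ) :
    sliceValues (((lexVal K).comap (funToUSeries hinj : FunField (Fin 4) K →+* USeries K)).comap
      (algebraMap (LocRing (Fin 4) K) (FunField (Fin 4) K))) n = polyValues ι z n := by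
  ext δ
  constructor
  · rintro ⟨a, ha⟩
    obtain ⟨p, -, hp⟩ := exists_val_locRing_eq trivialOn_lexVal (locToUSeries hinj)
      (fun i => hι.funToUSeries_X_pos hinj hz i) a
    rw [locToUSeries_algebraMap] at hp
    have h1 := (lexVal_eq_iff.1 (hp.symm.trans ha)).2
    rw [coeff_seriesMap] at h1
    exact ⟨_, degreeOf_coeff_blowUp_le p n, h1⟩
  · rintro ⟨q, hq, hδ⟩
    obtain ⟨p, hp⟩ := exists_blowUp_eq_monomial hq
    refine ⟨algebraMap _ _ p, ?_⟩
    change lexVal K (locToUSeries hinj _) = _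
    rw [locToUSeries_algebraMap, hp, seriesMap_monomial]
    exact lexVal_single hδ

/-- In `u`-adic value `0` only the constant coefficient matters, so the values are those of
`K[x, y]_{(x, y)}`. -/
theorem IsAdmissible.sliceValues_zero (hι : IsAdmissible ι)
    (hinj : Function.Injective (evalZ ι z)) (hz : 0 < tVal K z) :
    sliceValues (((lexVal K).comap (funToUSeries hinj : FunField (Fin 4) K →+* USeries K)).comap
      (algebraMap (LocRing (Fin 4) K) (FunField (Fin 4) K))) 0 = F0 ι := by
  ext δ
  constructor
  · rintro ⟨a, ha⟩
    have h1 := (lexVal_eq_iff.1 ha).2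
    refine ⟨locKillUV K a, ?_⟩
    rw [← h1]
    exact congrArg (tVal K) (hι.coeff_zero_locToUSeries hinj hz a).symm
  · intro hδ
    refine (hι.sliceValues_eq hinj hz 0).ge ?_
    obtain ⟨p, hp⟩ := (hι.mem_F0_iff δ).1 hδ
    exact ⟨MvPolynomial.rename Fin.castSucc p, (degreeOf_rename_castSucc p).le, by
      rw [evalZ_rename, hp]⟩

end RankTwo

end ValSemigroup

end

open ValSemigroup
theorem mainTheorem6 (K : Type*) [Field K] [IsAlgClosed K] :
    -- an embedding `K(x, y) ⊂ K((t^ℚ))` of the required kind exists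
    (∃ ι : FunField (Fin 2) K →ₐ[K] HahnSeries ℚ K, IsAdmissible ι) ∧
    ∀ ι : FunField (Fin 2) K →ₐ[K] HahnSeries ℚ K, IsAdmissible ι →
      -- the inductive construction can be carried out
      (∃ (lam alpha tau : ℕ → ℚ) (f g : ℕ → MvPolynomial (Fin 2) K),
        IsConstruction ι lam alpha tau f g) ∧
      ∀ (lam alpha tau : ℕ → ℚ) (f g : ℕ → MvPolynomial (Fin 2) K),
        IsConstruction ι lam alpha tau f g →
        -- the limit series `z` exists and is transcendental over `K(x, y)`
        ∃ z : HahnSeries ℚ K, IsLimit (partialZ ι f g) z ∧ Transcendental ι.range z ∧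
          -- the modules `Tⁿ`, `n > 0`
          (∀ n : ℕ, 0 < n → ¬ IsFGOver (F0 ι) (polyValues ι z n)) ∧
          -- the ring `B = A[z]_{(x, y, z)}` and the module `T^∞`
          (Dominates (tVal K) (locAt ι z).subtype ∧ ringKrullDim (locAt ι z) = 3 ∧
            ¬ IsFGOver (F0 ι) (locValues ι z)) ∧
          -- the composite valuation `ν = ν₁ ∘ νb` of `K(x, y, u, v)`
          ∃ (ν : AddValuation (FunField (Fin 4) K) (WithTop (ℤ ×ₗ ℚ)))
            (ν₁ : AddValuation (FunField (Fin 4) K) (WithTop ℤ))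
            (νb : AddValuation (IsLocalRing.ResidueField (valRing ν₁)) (WithTop ℚ)),
            HasValueGroup ν ∧ HasValueGroup ν₁ ∧ HasValueGroup νb ∧
            IsComposite ν ν₁ νb ∧ valRank ν = 2 ∧
            -- `νb` is induced by the `t`-adic valuation through `ι` and `v / u ↦ z`
            (∃ φ : IsLocalRing.ResidueField (valRing ν₁) →+* HahnSeries ℚ K,
              νb = (tVal K).comap φ ∧
              (∀ p : MvPolynomial (Fin 2) K,
                ∃ h : ratFun (MvPolynomial.rename (Fin.castLE (by decide : 2 ≤ 4)) p)
                    ∈ valRing ν₁,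
                  φ (IsLocalRing.residue (valRing ν₁) ⟨_, h⟩) = ι (ratFun p)) ∧
              ∃ h : (ratFun (MvPolynomial.X 3) / ratFun (MvPolynomial.X 2) : FunField (Fin 4) K)
                  ∈ valRing ν₁,
                φ (IsLocalRing.residue (valRing ν₁) ⟨_, h⟩) = z) ∧
            Dominates ν (algebraMap (LocRing (Fin 4) K) (FunField (Fin 4) K)) ∧
            -- the center `P` of `ν₁` on `R`
            (∃ P : Ideal (LocRing (Fin 4) K),
              (∀ a : LocRing (Fin 4) K,
                a ∈ P ↔ 0 < ν₁ (algebraMap _ (FunField (Fin 4) K) a)) ∧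
              Nonempty ((LocRing (Fin 4) K ⧸ P) ≃ₐ[K] LocRing (Fin 2) K)) ∧
            ∀ n : ℤ, 0 < n →
              ¬ Module.Finite
                (GrResidual (ν.comap (algebraMap (LocRing (Fin 4) K) (FunField (Fin 4) K))))
                (GrSlice (ν.comap (algebraMap (LocRing (Fin 4) K) (FunField (Fin 4) K))) n) := by
  refine ⟨exists_isAdmissible K, fun ι hι => ⟨hι.exists_construction, ?_⟩⟩
  intro lam alpha tau f g hc
  obtain ⟨z, hz⟩ := hc.exists_limit hι
  have hinj := hc.evalZ_injective hι hz
  have hz0 := hc.limit_pos hz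
  have hT : ∀ n : ℕ, 0 < n → ¬ IsFGOver (F0 ι) (polyValues ι z n) := fun n hn =>
    hc.not_isFGOver hι hz (fun i => polyValues_mono z hn (hc.lam_mem_polyValues hz i))
      fun q ⟨p, _, hp⟩ => ⟨p, hp⟩
  have hTinf : ¬ IsFGOver (F0 ι) (locValues ι z) := by
    refine hc.not_isFGOver hι hz (fun i => ?_) fun q hq => (hι.mem_locValues_iff hz0 q).1 hq
    obtain ⟨p, -, hp⟩ := hc.lam_mem_polyValues hz i
    exact (hι.mem_locValues_iff hz0 _).2 ⟨p, hp⟩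
  refine ⟨z, hc.isLimit hι hz, transcendental_of_evalZ_injective hinj, hT,
    ⟨hι.dominates_locAt hinj hz0, ringKrullDim_locAt hinj, hTinf⟩, ?_⟩
  have hν := hasValueGroup_lexVal hι hinj
  refine ⟨_, uVal (funToUSeries hinj : FunField (Fin 4) K →+* USeries K), _, hν,
    hasValueGroup_uVal hν, hasValueGroup_resHom hν, isComposite_lexVal _, valRank_eq_two hν,
    ⟨resHom _, rfl, fun p => exists_resHom_residue_eq _ (funToUSeries_rename hinj p),
      exists_resHom_residue_eq _ ?_⟩, hι.dominates_lexVal hinj hz0,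
    ⟨RingHom.ker (locKillUV K), fun a => (hι.uVal_pos_iff hinj hz0 a).symm,
      ⟨Ideal.quotientKerAlgEquivOfSurjective locKillUV_surjective⟩⟩, fun n hn hfin => ?_⟩
  · change funToUSeries hinj (ratFun (MvPolynomial.X 3) / ratFun (MvPolynomial.X 2)) = _
    rw [map_div₀, funToUSeries_X_two, funToUSeries_X_three,
      div_eq_iff (HahnSeries.single_ne_zero one_ne_zero), HahnSeries.C_apply,
      HahnSeries.single_mul_single, zero_add, mul_one]
  · obtain ⟨k, rfl⟩ := Int.eq_ofNat_of_zero_le hn.le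
    have h := isFGOver_of_finite _ _ hfin
    rw [hι.sliceValues_zero hinj hz0, hι.sliceValues_eq hinj hz0] at h
    exact hT k (by omega) h
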